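/- For $x=(x_1,x_2)\in\mathbb R^2$ put $x^\perp=(-x_2,x_1)$. For $f_1,\dots,f_4\in L^2(\mathbb R^2;\mathbb C)$ let $$\mathcal T(f_1,f_2,f_3)(z)=\int_{\mathbb R}\int_{\mathbb R^2} f_1(x+z)\,f_2(\lambda x^\perp+z)\,\overline{f_3(x+\lambda x^\perp+z)}\,dx\,d\lambda,\qquad \mathcal E(f_1,f_2,f_3,f_4)=\int_{\mathbb R^2}\mathcal T(f_1,f_2,f_3)\,\overline{f_4}\,dz .$$ Let $H=-\Delta+|x|^2$ on $\mathbb R^2$, and for $n\ge 0$ let $\Pi_n$ be the orthogonal projection of $L^2(\mathbb R^2)$ onto $E_n=\{u\in L^2: Hu=2(n+1)u\}$ (with $Hu$ taken in the sense of tempered distributions). A sum $\sum_{n_1+n_2=n_3+n_4}a(n_1,n_2,n_3,n_4)$ is understood as the limit of the finite sums over $\{n\in A_1\times A_2\times A_3\times A_4: n_1+n_2=n_3+n_4\}$ as the finite sets $A_1,\dots,A_4\subset\mathbb N$ independently exhaust $\mathbb N=\{0,1,2,\dots\}$. (1) For all $f_1,\dots,f_4\in L^2(\mathbb R^2)$,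 the integral over $(\lambda,x)$ defining $\mathcal T(f_1,f_2,f_3)(z)$ converges absolutely for almost every $z$, the integral over $(\lambda,x,z)$ defining $\mathcal E$ converges absolutely, $\mathcal T(f_1,f_2,f_3)\in L^2$, all products $(\Pi_{n_1}f_1)(\Pi_{n_2}f_2)\overline{(\Pi_{n_3}f_3)}$ are in $L^2$ and all products $(\Pi_{n_1}f_1)(\Pi_{n_2}f_2)\overline{(\Pi_{n_3}f_3)}\,\overline{(\Pi_{n_4}f_4)}$ are integrable, and $$\mathcal E(f_1,f_2,f_3,f_4)=2\pi^2\sum_{n_1+n_2=n_3+n_4}\int_{\mathbb R^2}(\Pi_{n_1}f_1)(\Pi_{n_2}f_2)\overline{(\Pi_{n_3}f_3)}\,\overline{(\Pi_{n_4}f_4)}\,dx,$$ $$\mathcal T(f_1,f_2,f_3)=2\pi^2\sum_{n_1+n_2=n_3+n_4}\Pi_{n_4}\Big((\Pi_{n_1}f_1)(\Pi_{n_2}f_2)\overline{(\Pi_{n_3}f_3)}\Big)\quad\text{in }L^2(\mathbb R^2).$$ (2) If the $f_j$ are Schwartz functions, both series, as series over all quadruples with $n_1+n_2=n_3+n_4$,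 converge unconditionally (in $\mathbb C$ and in $L^2$ respectively), with the same sums. (3) Consequently $u:\mathbb R\to L^2(\mathbb R^2)$ solves (CR), $i\partial_t u=\mathcal T(u,u,u)$, if and only if $v(t)=u\big(t/(2\pi^2)\big)$ solves the resonant equation of the cubic Schrödinger equation with harmonic trapping, $i\partial_t v=\sum_{n_1+n_2=n_3+n_4}\Pi_{n_4}\big((\Pi_{n_1}v)(\Pi_{n_2}v)\overline{(\Pi_{n_3}v)}\big)$ (solutions being differentiable as maps into $L^2$, with equality at every $t\in\mathbb R$). -/

import Mathlib

open MeasureTheory Filter Topology Real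
open scoped SchwartzMap ComplexConjugate ENNReal Laplacian LineDeriv

noncomputable section

namespace CRHermite

/-- The Euclidean plane. -/
abbrev Plane : Type := EuclideanSpace ℝ (Fin 2)

/-- The Hilbert space `L²(ℝ²; ℂ)`. -/
abbrev L2 : Type := Lp ℂ 2 (volume : Measure Plane)

/-- A Schwartz function as an element of `L²`. -/
def ofSchwartz (f : 𝓢(Plane, ℂ)) : L2 := f.toLp 2 volume

/-- Rotation by a quarter turn, `(x₁, x₂)^⊥ = (-x₂, x₁)`. -/
def perp (x : Plane) : Plane := !₂[-x 1, x 0]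

/-- The integrand `f₁(x+z) f₂(λx^⊥+z) conj f₃(x+λx^⊥+z)` of the trilinear operator. -/
def crIntegrand (f₁ f₂ f₃ : Plane → ℂ) (l : ℝ) (x z : Plane) : ℂ :=
  f₁ (x + z) * f₂ (l • perp x + z) * conj (f₃ (x + l • perp x + z))

/-- `𝓣(f₁,f₂,f₃)(z) = ∫_ℝ ∫_{ℝ²} f₁(x+z) f₂(λx^⊥+z) conj f₃(x+λx^⊥+z) dx dλ`. -/
def crT (f₁ f₂ f₃ : Plane → ℂ) (z : Plane) : ℂ :=
  ∫ l : ℝ, ∫ x : Plane, crIntegrand f₁ f₂ f₃ l x z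

/-- `𝓔(f₁,f₂,f₃,f₄) = ⟨𝓣(f₁,f₂,f₃), f₄⟩`, where `⟨f, g⟩ = ∫ f conj g`. -/
def crE (f₁ f₂ f₃ f₄ : Plane → ℂ) : ℂ :=
  ∫ z : Plane, crT f₁ f₂ f₃ z * conj (f₄ z)

/-- The harmonic oscillator `H = -Δ + |x|²`, acting on tempered distributions. -/
def harmonicOscillator : 𝓢'(Plane, ℂ) →L[ℂ] 𝓢'(Plane, ℂ) :=
  -(LineDeriv.laplacianCLM ℂ Plane 𝓢'(Plane, ℂ)) +
    TemperedDistribution.smulLeftCLM ℂ (fun x : Plane => ((‖x‖ ^ 2 : ℝ) : ℂ))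

/-- The multiplier in `harmonicOscillator` is admissible for `smulLeftCLM`. -/
theorem hasTemperateGrowth_normSq :
    (fun x : Plane => ((‖x‖ ^ 2 : ℝ) : ℂ)).HasTemperateGrowth :=
  Function.HasTemperateGrowth.comp Function.Complex.hasTemperateGrowth_ofReal
    (Function.hasTemperateGrowth_norm_sq Plane)

theorem harmonicOscillator_apply_apply (T : 𝓢'(Plane, ℂ)) (g : 𝓢(Plane, ℂ)) :
    harmonicOscillator T g =
      T (-(Δ g) + SchwartzMap.smulLeftCLM ℂ (fun x : Plane => ((‖x‖ ^ 2 : ℝ) : ℂ)) g) := by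
  simp [harmonicOscillator, TemperedDistribution.laplacian_apply_apply]

/-- The continuous linear map `u ↦ Hu - 2(n+1)u` from `L²` to tempered distributions. -/
def eigenDefect (n : ℕ) : L2 →L[ℂ] 𝓢'(Plane, ℂ) :=
  (harmonicOscillator - ((2 * ((n : ℂ) + 1)) • ContinuousLinearMap.id ℂ 𝓢'(Plane, ℂ))).comp
    (Lp.toTemperedDistributionCLM ℂ (volume : Measure Plane) 2)

/-- `E_n = {u ∈ L² : Hu = 2(n+1)u}`. -/
def eigenspace (n : ℕ) : Submodule ℂ L2 :=
  LinearMap.ker (eigenDefect n : L2 →ₗ[ℂ] 𝓢'(Plane, ℂ))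

theorem mem_eigenspace_iff (n : ℕ) (u : L2) :
    u ∈ eigenspace n ↔
      harmonicOscillator (u : 𝓢'(Plane, ℂ)) = (2 * ((n : ℂ) + 1)) • (u : 𝓢'(Plane, ℂ)) := by
  simp [eigenspace, eigenDefect, sub_eq_zero]

instance instCompleteEigenspace (n : ℕ) : CompleteSpace (eigenspace n) :=
  IsClosed.completeSpace_coe (hs := (eigenDefect n).isClosed_ker)

/-- `Π_n`, the orthogonal projection of `L²` onto `E_n`. -/
def proj (n : ℕ) : L2 →L[ℂ] L2 := (eigenspace n).starProjection

/-- A square-integrable function as an element of `L²` (and `0` for other functions). -/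
def toL2 (g : Plane → ℂ) : L2 :=
  open Classical in if h : MemLp g 2 (volume : Measure Plane) then h.toLp g else 0

/-- The quartic integrand `(Π_{n₁}f₁)(Π_{n₂}f₂) conj(Π_{n₃}f₃) conj(Π_{n₄}f₄)`. -/
def quarticProduct (f₁ f₂ f₃ f₄ : L2) (n₁ n₂ n₃ n₄ : ℕ) (x : Plane) : ℂ :=
  proj n₁ f₁ x * proj n₂ f₂ x * conj (proj n₃ f₃ x) * conj (proj n₄ f₄ x)

/-- The cubic product `(Π_{n₁}f₁)(Π_{n₂}f₂) conj(Π_{n₃}f₃)`. -/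
def cubicProduct (f₁ f₂ f₃ : L2) (n₁ n₂ n₃ : ℕ) (x : Plane) : ℂ :=
  proj n₁ f₁ x * proj n₂ f₂ x * conj (proj n₃ f₃ x)

/-- `∫ (Π_{n₁}f₁)(Π_{n₂}f₂) conj(Π_{n₃}f₃) conj(Π_{n₄}f₄) dx`, for `n = (n₁,n₂,n₃,n₄)`. -/
def quarticTerm (f₁ f₂ f₃ f₄ : L2) (n : ℕ × ℕ × ℕ × ℕ) : ℂ :=
  ∫ x : Plane, quarticProduct f₁ f₂ f₃ f₄ n.1 n.2.1 n.2.2.1 n.2.2.2 x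

/-- `Π_{n₄}((Π_{n₁}f₁)(Π_{n₂}f₂) conj(Π_{n₃}f₃))`, for `n = (n₁,n₂,n₃,n₄)`. -/
def cubicTerm (f₁ f₂ f₃ : L2) (n : ℕ × ℕ × ℕ × ℕ) : L2 :=
  proj n.2.2.2 (toL2 (cubicProduct f₁ f₂ f₃ n.1 n.2.1 n.2.2.1))

/-- The resonance condition `n₁ + n₂ = n₃ + n₄`. -/
abbrev Resonant (n : ℕ × ℕ × ℕ × ℕ) : Prop := n.1 + n.2.1 = n.2.2.1 + n.2.2.2

/-- `∑_{n₁+n₂=n₃+n₄} a(n₁,n₂,n₃,n₄) = s`: the sums over the resonant quadruples of the boxes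
`A₁ × A₂ × A₃ × A₄`, with `A_j` finite sets of indices, converge to `s` as the four sets
independently exhaust `ℕ` (no enumeration or order of the indices is singled out). -/
def HasResonantSum {M : Type*} [AddCommMonoid M] [TopologicalSpace M]
    (a : ℕ × ℕ × ℕ × ℕ → M) (s : M) : Prop :=
  Tendsto (fun A : Finset ℕ × Finset ℕ × Finset ℕ × Finset ℕ =>
    ∑ n ∈ (A.1 ×ˢ A.2.1 ×ˢ A.2.2.1 ×ˢ A.2.2.2).filter Resonant, a n) atTop (𝓝 s)

/-- `u : ℝ → L²` is a global solution of `i ∂ₜu = 𝓣(u,u,u)`. -/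
def SolvesCR (u : ℝ → L2) : Prop :=
  ∀ t : ℝ, ∃ h : MemLp (crT (u t) (u t) (u t)) 2 (volume : Measure Plane),
    HasDerivAt u (-Complex.I • h.toLp (crT (u t) (u t) (u t))) t

/-- `v : ℝ → L²` is a global solution of the resonant equation
`i ∂ₜv = ∑_{n₁+n₂=n₃+n₄} Π_{n₄}((Π_{n₁}v)(Π_{n₂}v) conj(Π_{n₃}v))` of the Schrödinger equation
with harmonic trapping. -/
def SolvesResonant (v : ℝ → L2) : Prop :=
  ∀ t : ℝ, ∃ g : L2, HasResonantSum (cubicTerm (v t) (v t) (v t)) g ∧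
    HasDerivAt v (-Complex.I • g) t

end CRHermite

end

/-! Both sides are continuous and real-multilinear, so the theorem reduces to one computation on
Hermite functions plus a limit.

Continuity: for fixed `z`, Cauchy–Schwarz in `(λ, x)` separates `f₃` from `f₁ f₂`. The maps `x ↦ x +
λx^⊥` and `x ↦ -x + λx^⊥` are similarities of Jacobian `1 + λ²`, and `∫ dλ/(1 + λ²) = π`; hence
every integral converges absolutely and `‖𝓣(f₁,f₂,f₃)‖ ≤ π ‖f₁‖ ‖f₂‖ ‖f₃‖` (`lintegral_crAbs_sq_le`,
`norm_trilin_le`).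

Spectral side: the Gaussians `exp (a ⬝ x - a ⬝ a / 4 - |x|²/2)`, `a ∈ ℂ²`, generate the Hermite
functions: scaling `a` by `s` multiplies the part of level `n` by `sⁿ`. These functions are
eigenfunctions (`oscS_hermS`), they are complete (`eq_zero_of_inner_hermL`), and level `n` spans
`E_n` (`eigenspace_eq_span`).

Computation: on four generating Gaussians, `𝓔` equals `π` times the integral over `t ∈ (0, 2π]` of
the quartic integral with covectors rotated by `e^{it}, e^{it}, e^{-it}, e^{-it}`
(`integral_prod_genFun_corner`). Gaussian integration leaves `exp (α c + β c̄)`, with `c` the Cayley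
transform of `λ` on one side and `c = e^{2it}` on the other. The mean of this over the circle
depends only on `αβ`, and the two products agree by Lagrange's identity `(p ⬝ q)² + (p × q)² = (p ⬝
p)(q ⬝ q)`. Extracting Taylor coefficients turns the `t`-integral into `2π` times the resonance
condition, whence the constant `2π²` (`integral_prod_hermFun_corner`).

Summation: the sum over a box is therefore `𝓣` of truncated functions, truncated once more
(`sum_box_eq`), and converges because the truncations are contractions converging strongly to the
identity. For Schwartz data `‖Π_n f‖ = O(n⁻²)` gives absolute convergence. The evolution equations
then differ by the factor `2π²`, which a change of time absorbs. -/

noncomputable section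

namespace CRHermite

/-! ### Two-variable Hermite polynomials and their generating function -/

/-- The polynomials with generating function `∑ sⁿ hermPoly n X Y = exp (s X - s² Y)`. -/
def hermPoly : ℕ → ℂ → ℂ → ℂ
  | 0, _, _ => 1
  | 1, X, _ => X
  | n + 2, X, Y => (X * hermPoly (n + 1) X Y - 2 * Y * hermPoly n X Y) / ((n : ℂ) + 2)

@[simp] theorem hermPoly_zero (X Y : ℂ) : hermPoly 0 X Y = 1 := by rw [hermPoly]

@[simp] theorem hermPoly_one (X Y : ℂ) : hermPoly 1 X Y = X := by rw [hermPoly]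

theorem hermPoly_add_two (n : ℕ) (X Y : ℂ) :
    hermPoly (n + 2) X Y =
      (X * hermPoly (n + 1) X Y - 2 * Y * hermPoly n X Y) / ((n : ℂ) + 2) := by rw [hermPoly]

theorem natCast_add_two_ne_zero (n : ℕ) : (n : ℂ) + 2 ≠ 0 := by
  exact_mod_cast (Nat.succ_ne_zero (n + 1))

theorem hermPoly_recurrence (n : ℕ) (X Y : ℂ) :
    ((n : ℂ) + 2) * hermPoly (n + 2) X Y =
      X * hermPoly (n + 1) X Y - 2 * Y * hermPoly n X Y := by
  rw [hermPoly_add_two, mul_div_cancel₀ _ (natCast_add_two_ne_zero n)]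

theorem conj_hermPoly (n : ℕ) (X Y : ℂ) :
    conj (hermPoly n X Y) = hermPoly n (conj X) (conj Y) := by
  induction n using Nat.twoStepInduction with
  | zero => simp
  | one => simp
  | more n h0 h1 =>
    simp [hermPoly_add_two, h0, h1, Complex.conj_ofNat]

/-- The derivative of `hermPoly n` in the first variable. -/
def hermPolyDeriv : ℕ → ℂ → ℂ → ℂ
  | 0, _, _ => 0
  | n + 1, X, Y => hermPoly n X Y

theorem hasDerivAt_hermPoly (n : ℕ) (X Y : ℂ) :
    HasDerivAt (fun X => hermPoly n X Y) (hermPolyDeriv n X Y) X := by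
  induction n using Nat.twoStepInduction with
  | zero => simpa [hermPolyDeriv] using hasDerivAt_const X (1 : ℂ)
  | one => simpa [hermPolyDeriv] using hasDerivAt_id' X
  | more n h0 h1 =>
    simp only [hermPoly_add_two]
    have := (((hasDerivAt_id X).mul h1).sub (h0.const_mul (2 * Y))).div_const ((n : ℂ) + 2)
    refine this.congr_deriv ?_
    rw [div_eq_iff (natCast_add_two_ne_zero n)]
    cases n with
    | zero => simp [hermPolyDeriv]; ring
    | succ n =>
      simp only [hermPolyDeriv, id]
      have := hermPoly_recurrence n X Y
      push_cast
      linear_combination (-1 : ℂ) * this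

/-- Euler's identity: `hermPoly (n + 1)` is homogeneous of degree `n + 1` when `X` has weight 1 and
`Y` weight 2, and its `Y`-derivative is `-hermPolyDeriv n`. -/
theorem hermPoly_euler (n : ℕ) (X Y : ℂ) :
    X * hermPolyDeriv (n + 1) X Y - 2 * Y * hermPolyDeriv n X Y =
      ((n : ℂ) + 1) * hermPoly (n + 1) X Y := by
  cases n with
  | zero => simp [hermPolyDeriv]
  | succ n =>
    simp only [hermPolyDeriv]
    have := hermPoly_recurrence n X Y
    push_cast
    linear_combination (-1 : ℂ) * this

/-- The generating function of the polynomials `hermPoly n`. -/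
def hermGen (X Y s : ℂ) : ℂ := Complex.exp (s * X - s ^ 2 * Y)

theorem differentiable_hermGen (X Y : ℂ) : Differentiable ℂ (hermGen X Y) := by
  unfold hermGen; fun_prop

theorem hasDerivAt_hermGen (X Y s : ℂ) :
    HasDerivAt (hermGen X Y) ((X - 2 * Y * s) * hermGen X Y s) s := by
  have h : HasDerivAt (fun s : ℂ => s * X - s ^ 2 * Y) (X - 2 * Y * s) s := by
    have := ((hasDerivAt_id s).mul_const X).sub (((hasDerivAt_id s).pow 2).mul_const Y)
    refine this.congr_deriv ?_
    simp; ring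
  exact h.cexp.congr_deriv (by unfold hermGen; ring)

/-- Leibniz's rule applied to `G' = (X - 2Ys) G`; the coefficient is affine in `s`, so only two
terms survive. At `s = 0` this is the recurrence of `hermPoly` up to factorials. -/
theorem iteratedDeriv_hermGen_add_two (X Y : ℂ) (n : ℕ) :
    iteratedDeriv (n + 2) (hermGen X Y) = fun s =>
      (X - 2 * Y * s) * iteratedDeriv (n + 1) (hermGen X Y) s
        - 2 * Y * ((n : ℂ) + 1) * iteratedDeriv n (hermGen X Y) s := by
  have hd : ∀ m s, HasDerivAt (iteratedDeriv m (hermGen X Y))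
      (iteratedDeriv (m + 1) (hermGen X Y) s) s := by
    intro m s
    rw [iteratedDeriv_succ]
    refine DifferentiableAt.hasDerivAt ?_
    have hc : ContDiff ℂ (⊤ : ℕ∞) (hermGen X Y) := (differentiable_hermGen X Y).contDiff
    exact (hc.differentiable_iteratedDeriv m (by exact_mod_cast ENat.natCast_lt_top m)) s
  have hlin : ∀ s : ℂ, HasDerivAt (fun s : ℂ => X - 2 * Y * s) (-(2 * Y)) s := by
    intro s
    simpa using ((hasDerivAt_id s).const_mul (2 * Y)).const_sub X
  induction n with
  | zero =>
    funext s
    have h1 : iteratedDeriv 1 (hermGen X Y) = fun s => (X - 2 * Y * s) * hermGen X Y s := by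
      funext s; rw [iteratedDeriv_one]; exact (hasDerivAt_hermGen X Y s).deriv
    rw [iteratedDeriv_succ]
    have := (hlin s).mul (hasDerivAt_hermGen X Y s)
    rw [h1]
    refine this.deriv.trans ?_
    simp; ring
  | succ n ih =>
    funext s
    conv_lhs => rw [iteratedDeriv_succ, ih]
    have := ((hlin s).mul (hd (n + 1) s)).sub ((hd n s).const_mul (2 * Y * ((n : ℂ) + 1)))
    refine this.deriv.trans ?_
    push_cast; ring

theorem iteratedDeriv_hermGen_zero (X Y : ℂ) (n : ℕ) :
    iteratedDeriv n (hermGen X Y) 0 = (n.factorial : ℂ) * hermPoly n X Y := by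
  induction n using Nat.twoStepInduction with
  | zero => simp [hermGen]
  | one =>
    rw [iteratedDeriv_one, (hasDerivAt_hermGen X Y 0).deriv]; simp [hermGen]
  | more n h0 h1 =>
    rw [iteratedDeriv_hermGen_add_two]
    beta_reduce
    rw [h0, h1]
    have := hermPoly_recurrence n X Y
    simp only [Nat.factorial_succ]
    push_cast
    linear_combination (-((n : ℂ) + 1) * n.factorial) * this

theorem hasSum_hermPoly (X Y s : ℂ) :
    HasSum (fun n : ℕ => s ^ n * hermPoly n X Y) (hermGen X Y s) := by
  have := Complex.hasSum_taylorSeries_of_entire (differentiable_hermGen X Y) 0 s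
  have e : (fun n : ℕ => s ^ n * hermPoly n X Y) =
      fun n : ℕ => ((n.factorial : ℂ)⁻¹) • (s - 0) ^ n • iteratedDeriv n (hermGen X Y) 0 := by
    funext n
    rw [iteratedDeriv_hermGen_zero, smul_eq_mul, smul_eq_mul, sub_zero]
    have hf : (n.factorial : ℂ) ≠ 0 := by exact_mod_cast n.factorial_ne_zero
    field_simp
  rw [e]
  exact this

/-- Cauchy's estimate on the circle of radius 2; any radius above 1 would make the series at `s = 1`
converge geometrically. -/
theorem norm_hermPoly_le (X Y : ℂ) (n : ℕ) :
    ‖hermPoly n X Y‖ ≤ Real.exp (2 * ‖X‖ + 4 * ‖Y‖) / 2 ^ n := by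
  have h := Complex.norm_iteratedDeriv_le_of_forall_mem_sphere_norm_le (f := hermGen X Y) (c := 0)
    (R := 2) (C := Real.exp (2 * ‖X‖ + 4 * ‖Y‖)) n (by norm_num)
    (differentiable_hermGen X Y).diffContOnCl (by
      intro s hs
      have hs : ‖s‖ = 2 := by simpa using hs
      rw [hermGen, Complex.norm_exp]
      refine Real.exp_le_exp.2 ((Complex.re_le_norm _).trans ((norm_sub_le _ _).trans ?_))
      rw [norm_mul, norm_mul, norm_pow, hs]; norm_num)
  rw [iteratedDeriv_hermGen_zero, norm_mul, Complex.norm_natCast, mul_div_assoc] at h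
  exact le_of_mul_le_mul_left h (by positivity)

/-- Cauchy's formula for the `n`-th Taylor coefficient, on the unit circle. On that circle rescaling
a covector preserves its size, so Gaussian majorants stay uniform in `θ`. -/
theorem hermPoly_eq_integral (X Y : ℂ) (n : ℕ) :
    ∫ θ : ℝ in (0)..(2 * π), Complex.exp (-(n * θ * Complex.I)) *
      hermGen X Y (Complex.exp (θ * Complex.I)) = 2 * π * hermPoly n X Y := by
  have h := (differentiable_hermGen X Y).diffContOnCl.circleIntegral_one_div_sub_center_pow_smul
    (c := 0) (R := 1) one_pos n
  rw [iteratedDeriv_hermGen_zero, circleIntegral] at h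
  simp only [deriv_circleMap, circleMap_zero, smul_eq_mul, sub_zero, Complex.ofReal_one, one_mul]
    at h
  have hf : (n.factorial : ℂ) ≠ 0 := by exact_mod_cast n.factorial_ne_zero
  have h2 : (2 * π * Complex.I / n.factorial) * (n.factorial * hermPoly n X Y)
      = (2 * π * hermPoly n X Y) * Complex.I := by field_simp
  rw [h2] at h
  refine mul_right_cancel₀ Complex.I_ne_zero (Eq.trans ?_ h)
  rw [← intervalIntegral.integral_mul_const]
  refine intervalIntegral.integral_congr fun θ _ => ?_
  have : Complex.exp (-(n * θ * Complex.I)) = 1 / Complex.exp (θ * Complex.I) ^ n := by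
    rw [← Complex.exp_nat_mul, Complex.exp_neg, mul_assoc, one_div]
  rw [this, pow_succ]
  have h0 := Complex.exp_ne_zero (θ * Complex.I)
  field_simp

/-! ### The Gaussian as a Schwartz function -/

theorem one_add_pow_mul_exp_neg_sq_le (m : ℕ) {r : ℝ} (hr : 0 ≤ r) :
    (1 + r) ^ m * Real.exp (-(r ^ 2 / 2)) ≤ m.factorial * Real.exp 2 := by
  have h1 := Real.pow_div_factorial_le_exp (1 + r) (by positivity) m
  rw [div_le_iff₀ (by positivity)] at h1
  calc (1 + r) ^ m * Real.exp (-(r ^ 2 / 2))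
      ≤ Real.exp (1 + r) * m.factorial * Real.exp (-(r ^ 2 / 2)) := by gcongr
    _ = m.factorial * Real.exp (1 + r + -(r ^ 2 / 2)) := by rw [Real.exp_add (1 + r)]; ring
    _ ≤ m.factorial * Real.exp 2 := by
        gcongr
        -- The maximum of `1 + r - r²/2` is `3/2`, at `r = 1`.
        nlinarith [sq_nonneg (r - 1)]

/-- By the bound for derivatives of a composition, each derivative is the Gaussian times at most a
polynomial, since all derivatives of `exp` are `exp`. -/
theorem exists_bound_iteratedFDeriv_gaussian (k n : ℕ) :
    ∃ C : ℝ, ∀ x : Plane,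
      ‖x‖ ^ k * ‖iteratedFDeriv ℝ n (fun x : Plane => Real.exp (-(‖x‖ ^ 2 / 2))) x‖ ≤ C := by
  have hq : (fun x : Plane => -(‖x‖ ^ 2 / 2)).HasTemperateGrowth := by
    have := (Function.HasTemperateGrowth.const (E := Plane) (-(1 / 2) : ℝ)).mul
      (Function.hasTemperateGrowth_norm_sq Plane)
    refine (congrArg Function.HasTemperateGrowth ?_).mp this
    funext x; simp only [Pi.mul_apply]; ring
  obtain ⟨l, C, hC, h⟩ := hq.norm_iteratedFDeriv_le_uniform n
  refine ⟨n.factorial * (C + 1) ^ n * ((k + l * n).factorial * Real.exp 2), fun x => ?_⟩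
  have hx : (1 : ℝ) ≤ 1 + ‖x‖ := by linarith [norm_nonneg x]
  have hb := norm_iteratedFDeriv_comp_le (𝕜 := ℝ) (g := Real.exp)
    (f := fun x : Plane => -(‖x‖ ^ 2 / 2)) (n := n) (N := (n : ℕ∞))
    Real.contDiff_exp (hq.1.of_le (by exact_mod_cast le_top)) le_rfl x
    (C := Real.exp (-(‖x‖ ^ 2 / 2))) (D := (C + 1) * (1 + ‖x‖) ^ l)
    (fun i _ => by
      rw [norm_iteratedFDeriv_eq_norm_iteratedDeriv, iteratedDeriv_eq_iterate,
        Real.iter_deriv_exp, Real.norm_of_nonneg (Real.exp_pos _).le])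
    (fun i hi hin => by
      refine (h i hin x).trans ?_
      -- The composition bound wants the `i`-th derivative below `D ^ i`; taking `C + 1` makes `D ≥
      -- 1`, so that `D ≤ D ^ i` for `i ≥ 1`.
      have h1 : (1 : ℝ) ≤ (C + 1) * (1 + ‖x‖) ^ l := by
        have := one_le_pow₀ hx (n := l)
        nlinarith
      calc C * (1 + ‖x‖) ^ l ≤ (C + 1) * (1 + ‖x‖) ^ l := by gcongr; linarith
        _ ≤ ((C + 1) * (1 + ‖x‖) ^ l) ^ i := le_self_pow₀ h1 (by omega))
  calc ‖x‖ ^ k * ‖iteratedFDeriv ℝ n (fun x : Plane => Real.exp (-(‖x‖ ^ 2 / 2))) x‖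
      ≤ (1 + ‖x‖) ^ k * (n.factorial * Real.exp (-(‖x‖ ^ 2 / 2)) *
          ((C + 1) * (1 + ‖x‖) ^ l) ^ n) := by
        gcongr
        · linarith
        · exact hb
    _ = n.factorial * (C + 1) ^ n * ((1 + ‖x‖) ^ (k + l * n) * Real.exp (-(‖x‖ ^ 2 / 2))) := by
        rw [mul_pow, ← pow_mul, pow_add]; ring
    _ ≤ _ := by
        exact mul_le_mul_of_nonneg_left (one_add_pow_mul_exp_neg_sq_le _ (norm_nonneg x))
          (by positivity)

/-- The Gaussian `exp (-|x|²/2)`. -/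
def gaussS : 𝓢(Plane, ℂ) where
  toFun x := ((Real.exp (-(‖x‖ ^ 2 / 2)) : ℝ) : ℂ)
  smooth' := by
    have : ContDiff ℝ (⊤ : ℕ∞) (fun x : Plane => Real.exp (-(‖x‖ ^ 2 / 2))) :=
      Real.contDiff_exp.comp ((contDiff_norm_sq ℝ).div_const 2).neg
    exact Complex.ofRealCLM.contDiff.comp this
  decay' k n := by
    obtain ⟨C, hC⟩ := exists_bound_iteratedFDeriv_gaussian k n
    refine ⟨C, fun x => ?_⟩
    have hc : ContDiff ℝ (⊤ : ℕ∞) (fun x : Plane => Real.exp (-(‖x‖ ^ 2 / 2))) :=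
      Real.contDiff_exp.comp ((contDiff_norm_sq ℝ).div_const 2).neg
    have := Complex.ofRealLI.norm_iteratedFDeriv_comp_left (hc.contDiffAt (x := x)) (i := n)
      (by exact_mod_cast le_top)
    refine le_of_eq_of_le ?_ (hC x)
    rw [← this]; rfl

theorem norm_sq_plane (x : Plane) : ‖x‖ ^ 2 = x 0 ^ 2 + x 1 ^ 2 := by
  rw [EuclideanSpace.norm_sq_eq]; simp

/-- The function `exp (-|x|²/2)` with complex values. -/
def gaussFun (x : Plane) : ℂ := Complex.exp (-(((x 0 : ℂ) ^ 2 + (x 1 : ℂ) ^ 2) / 2))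

theorem gaussFun_eq (x : Plane) : gaussFun x = ((Real.exp (-(‖x‖ ^ 2 / 2)) : ℝ) : ℂ) := by
  rw [gaussFun, norm_sq_plane]; push_cast; rfl

theorem norm_gaussFun (x : Plane) : ‖gaussFun x‖ = Real.exp (-(‖x‖ ^ 2 / 2)) := by
  rw [gaussFun_eq, Complex.norm_real, Real.norm_of_nonneg (Real.exp_pos _).le]

theorem gaussS_apply (x : Plane) : gaussS x = gaussFun x := (gaussFun_eq x).symm

/-! ### Hermite functions -/

/-- The complex bilinear pairing `a ⬝ x`. -/
def dotC (a : Fin 2 → ℂ) (x : Plane) : ℂ := a 0 * x 0 + a 1 * x 1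

/-- A quarter of the complex square `a ⬝ a`. -/
def quarterSq (a : Fin 2 → ℂ) : ℂ := (a 0 ^ 2 + a 1 ^ 2) / 4

theorem dotC_smul (s : ℂ) (a : Fin 2 → ℂ) (x : Plane) : dotC (s • a) x = s * dotC a x := by
  simp [dotC]; ring

theorem quarterSq_smul (s : ℂ) (a : Fin 2 → ℂ) : quarterSq (s • a) = s ^ 2 * quarterSq a := by
  simp [quarterSq]; ring

theorem conj_dotC (a : Fin 2 → ℂ) (x : Plane) : conj (dotC a x) = dotC (star a) x := by
  simp [dotC]

theorem conj_quarterSq (a : Fin 2 → ℂ) : conj (quarterSq a) = quarterSq (star a) := by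
  simp [quarterSq, Complex.conj_ofNat]

theorem conj_gaussFun (x : Plane) : conj (gaussFun x) = gaussFun x := by
  rw [gaussFun_eq, Complex.conj_ofReal]

theorem dotC_hasTemperateGrowth (a : Fin 2 → ℂ) : (dotC a).HasTemperateGrowth := by
  have h : ∀ i : Fin 2, (fun x : Plane => ((x i : ℝ) : ℂ)).HasTemperateGrowth := fun i =>
    (Complex.ofRealCLM.comp (EuclideanSpace.proj i : Plane →L[ℝ] ℝ)).hasTemperateGrowth
  exact ((Function.HasTemperateGrowth.const (a 0)).mul (h 0)).add
    ((Function.HasTemperateGrowth.const (a 1)).mul (h 1))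

/-- Multiplication by `a ⬝ x` on Schwartz functions. -/
def mulDot (a : Fin 2 → ℂ) : 𝓢(Plane, ℂ) →L[ℂ] 𝓢(Plane, ℂ) := SchwartzMap.smulLeftCLM ℂ (dotC a)

@[simp] theorem mulDot_apply (a : Fin 2 → ℂ) (f : 𝓢(Plane, ℂ)) (x : Plane) :
    mulDot a f x = dotC a x * f x := by
  rw [mulDot, SchwartzMap.smulLeftCLM_apply_apply (dotC_hasTemperateGrowth a), smul_eq_mul]

/-- The Hermite functions `hermPoly n (a ⬝ x) (a ⬝ a / 4) exp (-|x|²/2)`. -/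
def hermS (a : Fin 2 → ℂ) : ℕ → 𝓢(Plane, ℂ)
  | 0 => gaussS
  | 1 => mulDot a gaussS
  | n + 2 => ((n : ℂ) + 2)⁻¹ • (mulDot a (hermS a (n + 1)) - (2 * quarterSq a) • hermS a n)

/-- The Hermite functions as plain functions. -/
def hermFun (a : Fin 2 → ℂ) (n : ℕ) (x : Plane) : ℂ :=
  hermPoly n (dotC a x) (quarterSq a) * gaussFun x

theorem hermS_apply (a : Fin 2 → ℂ) (n : ℕ) (x : Plane) : hermS a n x = hermFun a n x := by
  unfold hermFun
  induction n using Nat.twoStepInduction with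
  | zero => simp [hermS, gaussS_apply]
  | one => simp [hermS, gaussS_apply]
  | more n h0 h1 =>
    simp only [hermS, _root_.smul_apply, _root_.sub_apply, mulDot_apply, h0, h1,
      hermPoly_add_two, smul_eq_mul]
    ring

theorem conj_hermFun (a : Fin 2 → ℂ) (n : ℕ) (x : Plane) :
    conj (hermFun a n x) = hermFun (star a) n x := by
  rw [hermFun, map_mul, conj_hermPoly, conj_gaussFun, conj_dotC, conj_quarterSq, hermFun]

/-! ### The Hermite functions are eigenfunctions -/

/-- The function by which differentiation lowers `hermFun`. -/
def hermFunDeriv (a : Fin 2 → ℂ) (n : ℕ) (x : Plane) : ℂ :=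
  hermPolyDeriv n (dotC a x) (quarterSq a) * gaussFun x

theorem hasDerivAt_dotC (a : Fin 2 → ℂ) (x m : Plane) :
    HasDerivAt (fun t : ℝ => dotC a (x + t • m)) (dotC a m) 0 := by
  have h : ∀ i : Fin 2, HasDerivAt (fun t : ℝ => (((x + t • m) i : ℝ) : ℂ)) (m i : ℂ) 0 := by
    intro i
    have : HasDerivAt (fun t : ℝ => x i + t * m i) (m i) 0 := by
      simpa using ((hasDerivAt_id (0 : ℝ)).mul_const (m i)).const_add (x i)
    simpa using this.ofReal_comp
  exact ((h 0).const_mul (a 0)).add ((h 1).const_mul (a 1))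

theorem hasDerivAt_gaussFun (x m : Plane) :
    HasDerivAt (fun t : ℝ => gaussFun (x + t • m))
      (-((m 0 : ℂ) * x 0 + m 1 * x 1) * gaussFun x) 0 := by
  have h : ∀ i : Fin 2, HasDerivAt (fun t : ℝ => (((x + t • m) i : ℝ) : ℂ)) (m i : ℂ) 0 := by
    intro i
    have : HasDerivAt (fun t : ℝ => x i + t * m i) (m i) 0 := by
      simpa using ((hasDerivAt_id (0 : ℝ)).mul_const (m i)).const_add (x i)
    simpa using this.ofReal_comp
  have := ((((h 0).pow 2).add ((h 1).pow 2)).div_const 2).neg.cexp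
  refine this.congr_deriv ?_
  simp [gaussFun]
  ring

theorem hasDerivAt_hermFun (a : Fin 2 → ℂ) (n : ℕ) (x m : Plane) :
    HasDerivAt (fun t : ℝ => hermFun a n (x + t • m))
      (dotC a m * hermFunDeriv a n x - ((m 0 : ℂ) * x 0 + m 1 * x 1) * hermFun a n x) 0 := by
  have h1 := (hasDerivAt_hermPoly n (dotC a (x + (0 : ℝ) • m)) (quarterSq a)).comp_of_eq
    (0 : ℝ) (hasDerivAt_dotC a x m) rfl
  have := h1.mul (hasDerivAt_gaussFun x m)
  refine this.congr_deriv ?_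
  simp [hermFun, hermFunDeriv]
  ring

theorem hasDerivAt_hermFunDeriv (a : Fin 2 → ℂ) (n : ℕ) (x m : Plane) :
    HasDerivAt (fun t : ℝ => hermFunDeriv a n (x + t • m))
      (dotC a m * (match n with | 0 => 0 | n + 1 => hermFunDeriv a n x)
        - ((m 0 : ℂ) * x 0 + m 1 * x 1) * hermFunDeriv a n x) 0 := by
  cases n with
  | zero => simpa [hermFunDeriv, hermPolyDeriv] using hasDerivAt_const (0 : ℝ) (0 : ℂ)
  | succ n => exact hasDerivAt_hermFun a n x m

theorem lineDeriv_hermS (a : Fin 2 → ℂ) (n : ℕ) (x m : Plane) :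
    (∂_{m} (hermS a n)) x =
      dotC a m * hermFunDeriv a n x - ((m 0 : ℂ) * x 0 + m 1 * x 1) * hermFun a n x := by
  rw [SchwartzMap.lineDerivOp_apply]
  have : ⇑(hermS a n) = hermFun a n := funext (hermS_apply a n)
  rw [this]
  exact (hasDerivAt_hermFun a n x m).deriv

theorem lineDeriv_lineDeriv_hermS (a : Fin 2 → ℂ) (n : ℕ) (x m : Plane) :
    (∂_{m} (∂_{m} (hermS a n))) x =
      dotC a m ^ 2 * (match n with | 0 => 0 | n + 1 => hermFunDeriv a n x)
      - 2 * (dotC a m * ((m 0 : ℂ) * x 0 + m 1 * x 1)) * hermFunDeriv a n x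
      + (((m 0 : ℂ) * x 0 + m 1 * x 1) ^ 2 - ((m 0 : ℂ) ^ 2 + m 1 ^ 2)) * hermFun a n x := by
  rw [SchwartzMap.lineDerivOp_apply]
  have : ⇑(∂_{m} (hermS a n) : 𝓢(Plane, ℂ)) = fun x => dotC a m * hermFunDeriv a n x
      - dotC (fun i => (m i : ℂ)) x * hermFun a n x := funext fun x => lineDeriv_hermS a n x m
  rw [this]
  have h := ((hasDerivAt_hermFunDeriv a n x m).const_mul (dotC a m)).sub
    ((hasDerivAt_dotC (fun i => (m i : ℂ)) x m).mul (hasDerivAt_hermFun a n x m))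
  refine h.deriv.trans ?_
  simp [dotC]
  ring

/-- The harmonic oscillator on Schwartz functions. -/
def oscS (f : 𝓢(Plane, ℂ)) : 𝓢(Plane, ℂ) :=
  -(Δ f) + SchwartzMap.smulLeftCLM ℂ (fun x : Plane => ((‖x‖ ^ 2 : ℝ) : ℂ)) f

/-- Writing the function as `P g` with `g` the Gaussian, `H(P g) = (-ΔP + 2 x ⬝ ∇P + 2P) g`. Here `x
⬝ ∇P = X P'` and `ΔP = (a ⬝ a) P'' = 4Y P''`, so `hermPoly_euler` turns the first two terms into
`2nP`. -/
theorem oscS_hermS (a : Fin 2 → ℂ) (n : ℕ) :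
    oscS (hermS a n) = (2 * ((n : ℂ) + 1)) • hermS a n := by
  ext x
  rw [oscS, SchwartzMap.laplacian_eq_sum (EuclideanSpace.basisFun (Fin 2) ℝ), Fin.sum_univ_two,
    _root_.add_apply, _root_.neg_apply, _root_.add_apply,
    SchwartzMap.smulLeftCLM_apply_apply hasTemperateGrowth_normSq,
    lineDeriv_lineDeriv_hermS, lineDeriv_lineDeriv_hermS, _root_.smul_apply, hermS_apply,
    norm_sq_plane]
  simp only [EuclideanSpace.basisFun_apply, dotC, smul_eq_mul]
  rcases n with _ | n
  · simp [hermFunDeriv, hermPolyDeriv]; ring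
  · have := hermPoly_euler n (dotC a x) (quarterSq a)
    simp [hermFunDeriv, hermFun, hermPolyDeriv] at this ⊢
    simp only [dotC, quarterSq] at this ⊢
    linear_combination (2 * gaussFun x) * this

/-! ### Gaussian majorants -/

theorem integrable_exp_neg_mul_norm_sq {b : ℝ} (hb : 0 < b) :
    Integrable (fun x : Plane => Real.exp (-b * ‖x‖ ^ 2)) := by
  have h := (GaussianFourier.integrable_cexp_neg_mul_sq_norm_add (V := Plane) (b := (b : ℂ))
    (by simpa using hb) 0 0).norm
  refine h.congr (ae_of_all _ fun x => ?_)
  simp [Complex.norm_exp, ← Complex.ofReal_pow, ← Complex.ofReal_mul, ← Complex.ofReal_neg]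

/-- The majorant `exp (A|x| - |x|²/2)`. -/
def gaussDom (A : ℝ) (x : Plane) : ℝ := Real.exp (A * ‖x‖ - ‖x‖ ^ 2 / 2)

theorem gaussDom_pos (A : ℝ) (x : Plane) : 0 < gaussDom A x := Real.exp_pos _

theorem continuous_gaussDom (A : ℝ) : Continuous (gaussDom A) := by
  unfold gaussDom; fun_prop

theorem gaussDom_le (A : ℝ) (x : Plane) : gaussDom A x ≤ Real.exp (A ^ 2) := by
  unfold gaussDom
  exact Real.exp_le_exp.2 (by nlinarith [sq_nonneg (‖x‖ / 2 - A), sq_nonneg ‖x‖])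

theorem memLp_gaussDom (A : ℝ) : MemLp (gaussDom A) 2 := by
  rw [memLp_two_iff_integrable_sq (continuous_gaussDom A).aestronglyMeasurable]
  refine ((integrable_exp_neg_mul_norm_sq (b := 1 / 2) (by norm_num)).const_mul
    (Real.exp (2 * A ^ 2))).mono' ((continuous_gaussDom A).pow 2).aestronglyMeasurable
    (ae_of_all _ fun x => ?_)
  rw [Real.norm_of_nonneg (by positivity), gaussDom, ← Real.exp_nat_mul, ← Real.exp_add]
  exact Real.exp_le_exp.2 (by push_cast; nlinarith [sq_nonneg (‖x‖ - 2 * A)])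

/-- The size of a complex covector. -/
def covSize (a : Fin 2 → ℂ) : ℝ := ‖a 0‖ + ‖a 1‖

theorem norm_dotC_le (a : Fin 2 → ℂ) (x : Plane) : ‖dotC a x‖ ≤ covSize a * ‖x‖ := by
  have h : ∀ i, ‖(x i : ℂ)‖ ≤ ‖x‖ := fun i => by
    rw [Complex.norm_real]; exact PiLp.norm_apply_le x i
  calc ‖dotC a x‖ ≤ ‖a 0‖ * ‖(x 0 : ℂ)‖ + ‖a 1‖ * ‖(x 1 : ℂ)‖ := by
        refine (norm_add_le _ _).trans ?_
        rw [norm_mul, norm_mul]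
    _ ≤ ‖a 0‖ * ‖x‖ + ‖a 1‖ * ‖x‖ := by gcongr <;> exact h _
    _ = _ := by rw [covSize]; ring

theorem continuous_hermFun (a : Fin 2 → ℂ) (n : ℕ) : Continuous (hermFun a n) := by
  have : ⇑(hermS a n) = hermFun a n := funext (hermS_apply a n)
  rw [← this]; exact (hermS a n).continuous

theorem norm_hermFun_le (a : Fin 2 → ℂ) (n : ℕ) (x : Plane) :
    ‖hermFun a n x‖ ≤
      (1 / 2) ^ n * (Real.exp (4 * ‖quarterSq a‖) * gaussDom (2 * covSize a) x) := by
  rw [hermFun, norm_mul, norm_gaussFun]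
  calc _ ≤ Real.exp (2 * ‖dotC a x‖ + 4 * ‖quarterSq a‖) / 2 ^ n *
        Real.exp (-(‖x‖ ^ 2 / 2)) := by
        gcongr; exact norm_hermPoly_le _ _ _
    _ = (1 / 2) ^ n * (Real.exp (4 * ‖quarterSq a‖) *
          Real.exp (2 * ‖dotC a x‖ - ‖x‖ ^ 2 / 2)) := by
        rw [Real.exp_add, sub_eq_add_neg, Real.exp_add, one_div, inv_pow]; ring
    _ ≤ _ := by
        rw [gaussDom]
        refine mul_le_mul_of_nonneg_left (mul_le_mul_of_nonneg_left (Real.exp_le_exp.2 ?_)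
          (Real.exp_pos _).le) (by positivity)
        linarith [norm_dotC_le a x]

/-! ### Completeness of the Hermite functions -/

/-- The Hermite functions as elements of `L²`. -/
def hermL (n : ℕ) (a : Fin 2 → ℂ) : L2 := ofSchwartz (hermS a n)

/-- The embedding of Schwartz functions into `L²` as a continuous linear map. -/
def ofSchwartzCLM : 𝓢(Plane, ℂ) →L[ℂ] L2 := SchwartzMap.toLpCLM ℂ ℂ 2 volume

theorem ofSchwartz_ae (f : 𝓢(Plane, ℂ)) : ⇑(ofSchwartz f) =ᵐ[volume] f := f.coeFn_toLp 2 volume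

theorem hermL_ae (n : ℕ) (a : Fin 2 → ℂ) : ⇑(hermL n a) =ᵐ[volume] hermFun a n := by
  filter_upwards [ofSchwartz_ae (hermS a n)] with x hx
  rw [hermL, hx, hermS_apply]

theorem coe_L2_apply (u : L2) (g : 𝓢(Plane, ℂ)) :
    (u : 𝓢'(Plane, ℂ)) g = ∫ x, g x * u x := by
  rw [Lp.toTemperedDistribution_apply]; rfl

theorem inner_hermL (n : ℕ) (a : Fin 2 → ℂ) (u : L2) :
    inner ℂ (hermL n a) u = ∫ x, hermFun (star a) n x * u x := by
  rw [L2.inner_def]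
  refine integral_congr_ae ?_
  filter_upwards [hermL_ae n a] with x hx
  rw [hx, RCLike.inner_apply, mul_comm, conj_hermFun]

theorem inner_hermL_eq_apply (n : ℕ) (a : Fin 2 → ℂ) (u : L2) :
    inner ℂ (hermL n a) u = (u : 𝓢'(Plane, ℂ)) (hermS (star a) n) := by
  rw [inner_hermL, coe_L2_apply]; simp only [hermS_apply]

/-- Summing the vanishing pairings over `n` produces the generating function at `s = 1`.
Interchanging sum and integral is licensed by the factor `2⁻ⁿ` in `norm_hermFun_le`. -/
theorem integral_exp_dotC_mul_eq_zero {u : L2} (hu : ∀ n a, inner ℂ (hermL n a) u = 0)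
    (a : Fin 2 → ℂ) : ∫ x, Complex.exp (dotC a x) * (gaussFun x * u x) = 0 := by
  have hu' : ∀ n, ∫ x, hermFun a n x * u x = 0 := fun n => by
    have := hu n (star a); rwa [inner_hermL, star_star] at this
  have hdom : Integrable (fun x => Real.exp (4 * ‖quarterSq a‖) * gaussDom (2 * covSize a) x *
      ‖u x‖) := by
    have := ((memLp_gaussDom (2 * covSize a)).integrable_mul (Lp.memLp u).norm).const_mul
      (Real.exp (4 * ‖quarterSq a‖))
    refine this.congr (ae_of_all _ fun x => ?_)
    simp [mul_assoc]
  have hb : ∀ n x, ‖hermFun a n x * u x‖ ≤ (1 / 2) ^ n *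
      (Real.exp (4 * ‖quarterSq a‖) * gaussDom (2 * covSize a) x * ‖u x‖) := fun n x => by
    rw [norm_mul, ← mul_assoc]
    gcongr
    exact norm_hermFun_le a n x
  have hi : ∀ n, Integrable (fun x => hermFun a n x * u x) := fun n =>
    (hdom.const_mul ((1 / 2) ^ n)).mono'
      ((continuous_hermFun a n).aestronglyMeasurable.mul (Lp.aestronglyMeasurable u))
      (ae_of_all _ (hb n))
  have hs : Summable fun n : ℕ => ∫ x, ‖hermFun a n x * u x‖ := by
    refine Summable.of_nonneg_of_le (fun n => integral_nonneg fun x => norm_nonneg _)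
      (fun n => ?_) ((summable_geometric_two).mul_right
        (∫ x, Real.exp (4 * ‖quarterSq a‖) * gaussDom (2 * covSize a) x * ‖u x‖))
    rw [← integral_const_mul]
    exact integral_mono (hi n).norm (hdom.const_mul _) (hb n)
  have h := hasSum_integral_of_summable_integral_norm hi hs
  simp only [hu'] at h
  have h0 := h.unique hasSum_zero
  have he : ∀ x, ∑' n, hermFun a n x * u x =
      Complex.exp (-quarterSq a) * (Complex.exp (dotC a x) * (gaussFun x * u x)) := fun x => by
    have h1 := (hasSum_hermPoly (dotC a x) (quarterSq a) 1).mul_right (gaussFun x * u x)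
    simp only [one_pow, one_mul] at h1
    have h2 : (fun n => hermFun a n x * u x) = fun n =>
        hermPoly n (dotC a x) (quarterSq a) * (gaussFun x * u x) := by
      funext n; rw [hermFun]; ring
    rw [h2, h1.tsum_eq, hermGen, one_mul, one_pow, one_mul, sub_eq_add_neg, Complex.exp_add]
    ring
  simp only [he, integral_const_mul] at h0
  exact (mul_eq_zero.1 h0).resolve_left (Complex.exp_ne_zero _)

/-- With purely imaginary covectors the preceding lemma says that the Fourier transform of the
integrable function `gaussFun * u` vanishes; the Gaussian has no zeros, so `u = 0`. -/
theorem eq_zero_of_inner_hermL {u : L2} (hu : ∀ n a, inner ℂ (hermL n a) u = 0) : u = 0 := by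
  set w : Plane → ℂ := fun x => gaussFun x * u x with hw
  have hg : MemLp gaussFun 2 := by
    have := gaussS.memLp 2 volume
    have e : ⇑gaussS = gaussFun := funext gaussS_apply
    rwa [e] at this
  have hwi : Integrable w := hg.integrable_mul (Lp.memLp u)
  have hF : ∀ ξ : Plane, FourierTransform.fourier w ξ = 0 := fun ξ => by
    rw [Real.fourier_eq']
    rw [← integral_exp_dotC_mul_eq_zero hu (fun i => (-2 * π * ξ i : ℝ) * Complex.I)]
    refine integral_congr_ae (ae_of_all _ fun x => ?_)
    simp only [dotC, smul_eq_mul]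
    congr 2
    simp [PiLp.inner_apply, Fin.sum_univ_two]
    ring
  -- Fourier injectivity by duality: write `h` as the transform of a Schwartz function and move the
  -- transform onto `w`.
  have hT : ∀ h : 𝓢(Plane, ℂ), ∫ x, h x • w x = 0 := fun h => by
    have hflip := VectorFourier.integral_fourierIntegral_smul_eq_flip (L := innerₗ Plane)
      (μ := volume) (ν := volume) (e := Real.fourierChar) Real.continuous_fourierChar
      continuous_inner (FourierTransform.fourierInv h).integrable hwi
    have h1 : ∀ ξ, VectorFourier.fourierIntegral Real.fourierChar volume (innerₗ Plane)
        (⇑(FourierTransform.fourierInv h)) ξ = h ξ := fun ξ => by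
      have : FourierTransform.fourier (FourierTransform.fourierInv h) = h :=
        FourierTransform.fourier_fourierInv_eq h
      conv_rhs => rw [← this, SchwartzMap.fourier_coe]
      rfl
    have h2 : ∀ ξ, VectorFourier.fourierIntegral Real.fourierChar volume (innerₗ Plane).flip
        w ξ = 0 := fun ξ => by
      rw [← hF ξ, flip_innerₗ]; rfl
    simp only [h1, h2, smul_zero, integral_zero] at hflip
    exact hflip
  have hW : (memLp_one_iff_integrable.2 hwi).toLp w = 0 := by
    have hk := Lp.ker_toTemperedDistributionCLM_eq_bot (F := ℂ) (μ := (volume : Measure Plane))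
      (p := 1)
    rw [LinearMap.ker_eq_bot'] at hk
    refine hk _ ?_
    ext h
    rw [ContinuousLinearMap.coe_coe, Lp.toTemperedDistributionCLM_apply,
      Lp.toTemperedDistribution_apply]
    refine Eq.trans (integral_congr_ae ?_) (hT h)
    filter_upwards [(memLp_one_iff_integrable.2 hwi).coeFn_toLp] with x hx
    rw [hx]
  have hw0 : w =ᵐ[volume] 0 := by
    have h1 := (memLp_one_iff_integrable.2 hwi).coeFn_toLp
    rw [hW] at h1
    exact h1.symm.trans (Lp.coeFn_zero _ _ _)
  rw [Lp.eq_zero_iff_ae_eq_zero]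
  filter_upwards [hw0] with x hx
  exact (mul_eq_zero.1 hx).resolve_left (Complex.exp_ne_zero _)

/-! ### The eigenspaces -/

/-- `H` is symmetric for the bilinear pairing, without conjugation: the one by which `L²` functions
act as distributions. -/
theorem integral_oscS_mul (f g : 𝓢(Plane, ℂ)) :
    ∫ x, oscS g x * f x = ∫ x, g x * oscS f x := by
  have hV : ∀ h : 𝓢(Plane, ℂ), ∀ x, SchwartzMap.smulLeftCLM ℂ
      (fun x : Plane => ((‖x‖ ^ 2 : ℝ) : ℂ)) h x = ((‖x‖ ^ 2 : ℝ) : ℂ) * h x := fun h x => by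
    rw [SchwartzMap.smulLeftCLM_apply_apply hasTemperateGrowth_normSq, smul_eq_mul]
  have hi : ∀ h k : 𝓢(Plane, ℂ), Integrable (fun x => h x * k x) := fun h k =>
    (h.memLp 2 volume).integrable_mul (k.memLp 2 volume)
  have h1 := SchwartzMap.integral_mul_laplacian_right_eq_left (μ := volume) f g
  have e1 : (fun x => oscS g x * f x) = fun x => -(Δ g x * f x) + SchwartzMap.smulLeftCLM ℂ
      (fun x : Plane => ((‖x‖ ^ 2 : ℝ) : ℂ)) g x * f x := by
    funext x; simp [oscS]; ring
  have e2 : (fun x => g x * oscS f x) = fun x => -(g x * Δ f x) + g x * SchwartzMap.smulLeftCLM ℂ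
      (fun x : Plane => ((‖x‖ ^ 2 : ℝ) : ℂ)) f x := by
    funext x; simp [oscS]; ring
  have hn : ∀ h k : 𝓢(Plane, ℂ), Integrable (fun x => -(h x * k x)) := fun h k => (hi h k).neg
  rw [e1, e2, integral_add (hn _ _) (hi _ _), integral_add (hn _ _) (hi _ _),
    integral_neg, integral_neg]
  congr 1
  · simp only [mul_comm (g _), mul_comm (Δ g _)]; rw [h1]
  · simp only [hV]; congr 1; funext x; ring

theorem coe_ofSchwartz_apply (f g : 𝓢(Plane, ℂ)) :
    (ofSchwartz f : 𝓢'(Plane, ℂ)) g = ∫ x, g x * f x := by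
  rw [coe_L2_apply]
  refine integral_congr_ae ?_
  filter_upwards [ofSchwartz_ae f] with x hx
  rw [hx]

theorem harmonicOscillator_ofSchwartz (f : 𝓢(Plane, ℂ)) :
    harmonicOscillator (ofSchwartz f : 𝓢'(Plane, ℂ)) = (ofSchwartz (oscS f) : 𝓢'(Plane, ℂ)) := by
  ext g
  rw [harmonicOscillator_apply_apply, coe_ofSchwartz_apply, coe_ofSchwartz_apply]
  exact integral_oscS_mul f g

theorem ofSchwartz_smul (c : ℂ) (f : 𝓢(Plane, ℂ)) : ofSchwartz (c • f) = c • ofSchwartz f :=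
  map_smul ofSchwartzCLM c f

theorem hermL_mem_eigenspace (n : ℕ) (a : Fin 2 → ℂ) : hermL n a ∈ eigenspace n := by
  rw [mem_eigenspace_iff, hermL, harmonicOscillator_ofSchwartz, oscS_hermS, ofSchwartz_smul]
  exact map_smul (Lp.toTemperedDistributionCLM ℂ (volume : Measure Plane) 2) _ _

/-- Testing `Hu = 2(m+1)u` against a Hermite function of level `n` evaluates the pairing with both
eigenvalues, so `m - n` annihilates it. -/
theorem inner_hermL_of_mem {m n : ℕ} (hmn : n ≠ m) {u : L2} (hu : u ∈ eigenspace m)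
    (a : Fin 2 → ℂ) : inner ℂ (hermL n a) u = 0 := by
  rw [inner_hermL_eq_apply]
  rw [mem_eigenspace_iff] at hu
  have h1 := harmonicOscillator_apply_apply (u : 𝓢'(Plane, ℂ)) (hermS (star a) n)
  have h2 : -(Δ (hermS (star a) n)) + SchwartzMap.smulLeftCLM ℂ
      (fun x : Plane => ((‖x‖ ^ 2 : ℝ) : ℂ)) (hermS (star a) n) =
      (2 * ((n : ℂ) + 1)) • hermS (star a) n := oscS_hermS (star a) n
  rw [h2, hu, map_smul] at h1
  have h3 : (2 * ((m : ℂ) + 1)) * (u : 𝓢'(Plane, ℂ)) (hermS (star a) n) =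
      (2 * ((n : ℂ) + 1)) * (u : 𝓢'(Plane, ℂ)) (hermS (star a) n) := h1
  have h4 : ((m : ℂ) - n) * (u : 𝓢'(Plane, ℂ)) (hermS (star a) n) = 0 := by
    linear_combination h3 / 2
  refine (mul_eq_zero.1 h4).resolve_left (sub_ne_zero.2 ?_)
  exact_mod_cast hmn.symm

/-- A finite-dimensional space of Schwartz functions containing the Hermite functions of level `n`. -/
def polyGauss : ℕ → Submodule ℂ 𝓢(Plane, ℂ)
  | 0 => Submodule.span ℂ {gaussS}
  | n + 1 => polyGauss n ⊔ ((polyGauss n).map (mulDot ![1, 0] : 𝓢(Plane, ℂ) →ₗ[ℂ] 𝓢(Plane, ℂ)) ⊔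
      (polyGauss n).map (mulDot ![0, 1] : 𝓢(Plane, ℂ) →ₗ[ℂ] 𝓢(Plane, ℂ)))

theorem fg_polyGauss (n : ℕ) : (polyGauss n).FG := by
  induction n with
  | zero => exact Submodule.fg_span_singleton gaussS
  | succ n ih => exact ih.sup ((ih.map _).sup (ih.map _))

theorem mulDot_mem_polyGauss (a : Fin 2 → ℂ) {n : ℕ} {f : 𝓢(Plane, ℂ)} (hf : f ∈ polyGauss n) :
    mulDot a f ∈ polyGauss (n + 1) := by
  have : mulDot a f = a 0 • mulDot ![1, 0] f + a 1 • mulDot ![0, 1] f := by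
    ext x; simp [dotC]; ring
  rw [this, polyGauss]
  refine Submodule.mem_sup_right (Submodule.add_mem_sup ?_ ?_)
  · exact Submodule.smul_mem _ _ (Submodule.mem_map_of_mem hf)
  · exact Submodule.smul_mem _ _ (Submodule.mem_map_of_mem hf)

theorem polyGauss_le_succ (n : ℕ) : polyGauss n ≤ polyGauss (n + 1) := by
  rw [polyGauss]; exact le_sup_left

theorem hermS_mem_polyGauss (a : Fin 2 → ℂ) (n : ℕ) : hermS a n ∈ polyGauss n := by
  induction n using Nat.twoStepInduction with
  | zero => exact Submodule.mem_span_singleton_self _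
  | one => exact mulDot_mem_polyGauss a (n := 0) (Submodule.mem_span_singleton_self _)
  | more n h0 h1 =>
    exact Submodule.smul_mem _ _ (Submodule.sub_mem _ (mulDot_mem_polyGauss a h1)
      (Submodule.smul_mem _ _ (polyGauss_le_succ _ (polyGauss_le_succ _ h0))))

/-- Finite dimension makes the span complete, so that it has an orthogonal projection. -/
theorem finite_span_hermL (n : ℕ) :
    FiniteDimensional ℂ (Submodule.span ℂ (Set.range (hermL n))) := by
  have : FiniteDimensional ℂ ((polyGauss n).map (ofSchwartzCLM : 𝓢(Plane, ℂ) →ₗ[ℂ] L2)) :=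
    Module.Finite.iff_fg.2 ((fg_polyGauss n).map _)
  refine Submodule.finiteDimensional_of_le (S₂ := (polyGauss n).map
    (ofSchwartzCLM : 𝓢(Plane, ℂ) →ₗ[ℂ] L2)) (Submodule.span_le.2 ?_)
  rintro _ ⟨a, rfl⟩
  exact Submodule.mem_map_of_mem (hermS_mem_polyGauss a n)

/-- The part of `u ∈ E_n` orthogonal to the span still lies in `E_n`, hence is orthogonal to the
other levels too, and completeness kills it. -/
theorem eigenspace_eq_span (n : ℕ) :
    eigenspace n = Submodule.span ℂ (Set.range (hermL n)) := by
  have := finite_span_hermL n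
  have hle : Submodule.span ℂ (Set.range (hermL n)) ≤ eigenspace n := by
    rw [Submodule.span_le]; rintro _ ⟨a, rfl⟩; exact hermL_mem_eigenspace n a
  refine le_antisymm (fun u hu => ?_) hle
  set V := Submodule.span ℂ (Set.range (hermL n)) with hV
  have hd : u - V.starProjection u = 0 := by
    refine eq_zero_of_inner_hermL fun m a => ?_
    by_cases hmn : m = n
    · subst hmn
      exact Submodule.sub_starProjection_mem_orthogonal (K := V) u _
        (Submodule.subset_span ⟨a, rfl⟩)
    · exact inner_hermL_of_mem hmn (Submodule.sub_mem _ hu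
        (hle (Submodule.starProjection_apply_mem V u))) a
  rw [sub_eq_zero.1 hd]
  exact Submodule.starProjection_apply_mem V u

theorem proj_mem (n : ℕ) (f : L2) : proj n f ∈ eigenspace n :=
  Submodule.starProjection_apply_mem _ f

theorem proj_of_mem {n : ℕ} {u : L2} (hu : u ∈ eigenspace n) : proj n u = u :=
  Submodule.starProjection_eq_self_iff.2 hu

theorem inner_proj (n : ℕ) (f g : L2) : inner ℂ (proj n f) g = inner ℂ f (proj n g) :=
  Submodule.inner_starProjection_left_eq_right _ f g

theorem inner_eq_zero_of_mem {m n : ℕ} (hmn : n ≠ m) {u v : L2} (hv : v ∈ eigenspace n)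
    (hu : u ∈ eigenspace m) : inner ℂ v u = 0 := by
  rw [eigenspace_eq_span n] at hv
  induction hv using Submodule.span_induction with
  | mem x h => obtain ⟨a, rfl⟩ := h; exact inner_hermL_of_mem hmn hu a
  | zero => simp
  | add x y _ _ hx hy => rw [inner_add_left, hx, hy, add_zero]
  | smul c x _ hx => rw [inner_smul_left, hx, mul_zero]

theorem proj_of_mem_ne {m n : ℕ} (hmn : n ≠ m) {u : L2} (hu : u ∈ eigenspace m) :
    proj n u = 0 := by
  refine ext_inner_left ℂ fun v => ?_
  rw [← inner_proj, inner_zero_right, inner_eq_zero_of_mem hmn (proj_mem n v) hu]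

/-- The sum of the projections `Π_n`, `n ∈ A`. -/
def projSum (A : Finset ℕ) : L2 →L[ℂ] L2 := ∑ n ∈ A, proj n

theorem projSum_apply (A : Finset ℕ) (f : L2) : projSum A f = ∑ n ∈ A, proj n f := by
  simp [projSum]

theorem projSum_projSum (A : Finset ℕ) (f : L2) : projSum A (projSum A f) = projSum A f := by
  rw [projSum_apply A f, map_sum]
  refine Finset.sum_congr rfl fun n hn => ?_
  rw [projSum_apply, Finset.sum_eq_single n]
  · exact proj_of_mem (proj_mem n f)
  · intro m _ hmn; exact proj_of_mem_ne hmn (proj_mem n f)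
  · intro h; exact absurd hn h

theorem inner_projSum (A : Finset ℕ) (f g : L2) :
    inner ℂ (projSum A f) g = inner ℂ f (projSum A g) := by
  simp only [projSum_apply, sum_inner, inner_sum, inner_proj]

theorem norm_projSum_le (A : Finset ℕ) (f : L2) : ‖projSum A f‖ ≤ ‖f‖ := by
  have h : ‖projSum A f‖ * ‖projSum A f‖ ≤ ‖f‖ * ‖projSum A f‖ := by
    rw [← inner_self_eq_norm_mul_norm (𝕜 := ℂ), inner_projSum, projSum_projSum]
    exact (RCLike.re_le_norm _).trans (norm_inner_le_norm _ _)
  by_cases h0 : ‖projSum A f‖ = 0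
  · rw [h0]; exact norm_nonneg _
  · exact le_of_mul_le_mul_right h (lt_of_le_of_ne (norm_nonneg _) (Ne.symm h0))

/-- On the algebraic sum of the eigenspaces the net is eventually constant; that sum is dense by
completeness, and `norm_projSum_le` carries the limit to the closure. -/
theorem tendsto_projSum (f : L2) : Tendsto (fun A => projSum A f) atTop (𝓝 f) := by
  have key : ∀ g ∈ (⨆ n, eigenspace n), Tendsto (fun A => projSum A g) atTop (𝓝 g) := by
    intro g hg
    induction hg using Submodule.iSup_induction' with
    | mem n x hx =>
      refine tendsto_const_nhds.congr' ?_
      filter_upwards [eventually_ge_atTop ({n} : Finset ℕ)] with A hA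
      rw [projSum_apply, Finset.sum_eq_single n]
      · exact (proj_of_mem hx).symm
      · intro m _ hmn; exact proj_of_mem_ne hmn hx
      · intro h; exact absurd (hA (Finset.mem_singleton_self n)) h
    | zero => simp
    | add x y _ _ hx hy => simpa using hx.add hy
  have hdense : (⨆ n, eigenspace n).topologicalClosure = ⊤ := by
    rw [Submodule.topologicalClosure_eq_top_iff, eq_bot_iff]
    intro u hu
    refine (Submodule.mem_bot ℂ).2 (eq_zero_of_inner_hermL fun n a => ?_)
    exact hu _ (Submodule.mem_iSup_of_mem n (hermL_mem_eigenspace n a))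
  have hf : f ∈ closure ((⨆ n, eigenspace n : Submodule ℂ L2) : Set L2) := by
    rw [← Submodule.topologicalClosure_coe, hdense]; trivial
  rw [Metric.tendsto_nhds]
  intro ε hε
  obtain ⟨g, hg, hfg⟩ := Metric.mem_closure_iff.1 hf (ε / 3) (by positivity)
  filter_upwards [Metric.tendsto_nhds.1 (key g hg) (ε / 3) (by positivity)] with A hA
  calc dist (projSum A f) f
      ≤ dist (projSum A f) (projSum A g) + dist (projSum A g) g + dist g f :=
        dist_triangle4 _ _ _ _
    _ < ε / 3 + ε / 3 + ε / 3 := by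
        have h1 : dist (projSum A f) (projSum A g) ≤ dist f g := by
          rw [dist_eq_norm, dist_eq_norm, ← map_sub]; exact norm_projSum_le A _
        rw [dist_comm g f]
        linarith
    _ = ε := by ring

/-! ### Decay of the projections of Schwartz functions -/

theorem proj_ofSchwartz_oscS (n : ℕ) (f : 𝓢(Plane, ℂ)) :
    proj n (ofSchwartz (oscS f)) = (2 * ((n : ℂ) + 1)) • proj n (ofSchwartz f) := by
  have key : ∀ v ∈ eigenspace n, inner ℂ v (ofSchwartz (oscS f)) =
      (2 * ((n : ℂ) + 1)) * inner ℂ v (ofSchwartz f) := by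
    intro v hv
    rw [eigenspace_eq_span n] at hv
    induction hv using Submodule.span_induction with
    | mem x h =>
      obtain ⟨a, rfl⟩ := h
      rw [inner_hermL_eq_apply, inner_hermL_eq_apply, coe_ofSchwartz_apply, ← integral_oscS_mul,
        oscS_hermS, coe_ofSchwartz_apply, ← integral_const_mul]
      simp only [_root_.smul_apply, smul_eq_mul, mul_assoc]
    | zero => simp
    | add x y _ _ hx hy => rw [inner_add_left, hx, hy, inner_add_left]; ring
    | smul c x _ hx => rw [inner_smul_left, hx, inner_smul_left]; ring
  refine ext_inner_left ℂ fun v => ?_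
  rw [← inner_proj, key _ (proj_mem n v), inner_smul_right, ← inner_proj]

theorem norm_proj_le (n : ℕ) (f : L2) : ‖proj n f‖ ≤ ‖f‖ := by
  have := norm_projSum_le {n} f
  rwa [projSum_apply, Finset.sum_singleton] at this

/-- Two applications of `H` gain the factor `(2(n+1))²`; one would leave the harmonic series. -/
theorem summable_norm_proj_ofSchwartz (f : 𝓢(Plane, ℂ)) :
    Summable fun n => ‖proj n (ofSchwartz f)‖ := by
  have h : ∀ n : ℕ, ‖proj n (ofSchwartz f)‖ ≤
      ‖ofSchwartz (oscS (oscS f))‖ * (1 / ((n + 1 : ℕ) : ℝ) ^ 2) := by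
    intro n
    have h1 := norm_proj_le n (ofSchwartz (oscS (oscS f)))
    rw [proj_ofSchwartz_oscS, proj_ofSchwartz_oscS, norm_smul, norm_smul] at h1
    have h2 : ‖(2 * ((n : ℂ) + 1))‖ = 2 * ((n + 1 : ℕ) : ℝ) := by
      have : (2 * ((n : ℂ) + 1)) = ((2 * ((n + 1 : ℕ) : ℝ) : ℝ) : ℂ) := by push_cast; ring
      rw [this, Complex.norm_real, Real.norm_of_nonneg (by positivity)]
    rw [h2] at h1
    have h3 : (0 : ℝ) < ((n + 1 : ℕ) : ℝ) := by positivity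
    rw [mul_one_div, le_div_iff₀ (by positivity)]
    nlinarith [norm_nonneg (proj n (ofSchwartz f)), sq_nonneg (((n + 1 : ℕ) : ℝ)),
      mul_nonneg (norm_nonneg (proj n (ofSchwartz f))) (sq_nonneg (((n + 1 : ℕ) : ℝ)))]
  refine Summable.of_nonneg_of_le (fun _ => norm_nonneg _) h (Summable.mul_left _ ?_)
  exact (summable_nat_add_iff 1).2 (Real.summable_one_div_nat_pow.2 one_lt_two)

/-! ### Similarities of the plane -/

/-- The quarter turn as a linear map. -/
def perpL : Plane →ₗ[ℝ] Plane where
  toFun := perp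
  map_add' x y := by ext i; fin_cases i <;> simp [perp]; ring
  map_smul' c x := by ext i; fin_cases i <;> simp [perp]

/-- The similarity `x ↦ α x + β x^⊥`. -/
def shear (α β : ℝ) : Plane →ₗ[ℝ] Plane := α • LinearMap.id + β • perpL

theorem shear_apply (α β : ℝ) (x : Plane) : shear α β x = α • x + β • perp x := rfl

theorem det_shear (α β : ℝ) : LinearMap.det (shear α β) = α ^ 2 + β ^ 2 := by
  rw [← LinearMap.det_toMatrix (EuclideanSpace.basisFun (Fin 2) ℝ).toBasis, Matrix.det_fin_two]
  simp [LinearMap.toMatrix_apply, shear_apply, perp]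
  ring

theorem continuous_shear (α β : ℝ) : Continuous (shear α β) :=
  LinearMap.continuous_of_finiteDimensional _

theorem continuous_perp : Continuous perp :=
  LinearMap.continuous_of_finiteDimensional perpL

@[fun_prop] theorem measurable_perp : Measurable perp := continuous_perp.measurable

theorem map_shear {α β : ℝ} (h : α ^ 2 + β ^ 2 ≠ 0) :
    Measure.map (shear α β) volume = ENNReal.ofReal (α ^ 2 + β ^ 2)⁻¹ • (volume : Measure Plane) := by
  have hd : LinearMap.det (shear α β) ≠ 0 := by rwa [det_shear]
  rw [Measure.map_linearMap_addHaar_eq_smul_addHaar volume hd, det_shear,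
    abs_of_nonneg (by positivity)]

/-- Source of every weight `1/(1 + λ²)` in the estimates. -/
theorem lintegral_shear {α β : ℝ} (h : α ^ 2 + β ^ 2 ≠ 0) {F : Plane → ℝ≥0∞}
    (hF : Measurable F) (z : Plane) :
    ∫⁻ x, F (shear α β x + z) = ENNReal.ofReal (α ^ 2 + β ^ 2)⁻¹ * ∫⁻ x, F x := by
  have hF' : Measurable fun y => F (y + z) := hF.comp (measurable_id.add_const z)
  rw [← lintegral_map hF' (continuous_shear α β).measurable, map_shear h,
    lintegral_smul_measure, smul_eq_mul, lintegral_add_right_eq_self]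

theorem quasiMeasurePreserving_shear {α β : ℝ} (h : α ^ 2 + β ^ 2 ≠ 0) (z : Plane) :
    Measure.QuasiMeasurePreserving (fun x => shear α β x + z) volume volume := by
  have h1 : Measure.QuasiMeasurePreserving (shear α β) volume volume := by
    refine ⟨(continuous_shear α β).measurable, ?_⟩
    rw [map_shear h]
    exact Measure.smul_absolutelyContinuous
  exact (quasiMeasurePreserving_add_right volume z).comp h1

theorem lintegral_inv_one_add_sq :
    ∫⁻ l : ℝ, ENNReal.ofReal (1 + l ^ 2)⁻¹ = ENNReal.ofReal π := by
  rw [← integral_univ_inv_one_add_sq,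
    ofReal_integral_eq_lintegral_ofReal integrable_inv_one_add_sq
      (ae_of_all _ fun l => by positivity)]

/-! ### Absolute convergence -/

section

variable {f₁ f₂ f₃ f₄ g₁ g₂ g₃ : Plane → ℂ}

theorem measurable_crIntegrand (h₁ : Measurable f₁) (h₂ : Measurable f₂) (h₃ : Measurable f₃) :
    Measurable fun q : (ℝ × Plane) × Plane => crIntegrand f₁ f₂ f₃ q.1.1 q.1.2 q.2 := by
  unfold crIntegrand
  have hp : Measurable fun q : (ℝ × Plane) × Plane => q.1.1 • perp q.1.2 :=
    measurable_fst.fst.smul (measurable_perp.comp measurable_fst.snd)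
  refine ((h₁.comp (measurable_fst.snd.add measurable_snd)).mul
    (h₂.comp (hp.add measurable_snd))).mul ?_
  exact Complex.continuous_conj.measurable.comp
    (h₃.comp ((measurable_fst.snd.add hp).add measurable_snd))

/-- The integral of the absolute values defining `𝓣`. -/
def crAbs (f₁ f₂ f₃ : Plane → ℂ) (z : Plane) : ℝ≥0∞ :=
  ∫⁻ p : ℝ × Plane, ‖crIntegrand f₁ f₂ f₃ p.1 p.2 z‖ₑ

/-- The square of the `L²` norm. -/
def sqNorm (f : Plane → ℂ) : ℝ≥0∞ := ∫⁻ x, ‖f x‖ₑ ^ (2 : ℝ)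

theorem lintegral_diagonal_pair (h₁ : Measurable f₁) (h₂ : Measurable f₂) :
    ∫⁻ z : Plane, ∫⁻ p : ℝ × Plane, (‖f₁ (p.2 + z)‖ₑ * ‖f₂ (p.1 • perp p.2 + z)‖ₑ) ^ (2 : ℝ) =
      ENNReal.ofReal π * (sqNorm f₁ * sqNorm f₂) := by
  have hp : Measurable fun q : (ℝ × Plane) × Plane => q.1.1 • perp q.1.2 :=
    measurable_fst.fst.smul (measurable_perp.comp measurable_fst.snd)
  have hm1 : Measurable fun q : Plane × (ℝ × Plane) => f₁ (q.2.2 + q.1) :=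
    h₁.comp (measurable_snd.snd.add measurable_fst)
  have hm2 : Measurable fun q : Plane × (ℝ × Plane) => f₂ (q.2.1 • perp q.2.2 + q.1) :=
    h₂.comp ((hp.comp measurable_swap).add measurable_fst)
  have hF₁ : Measurable fun x => ‖f₁ x‖ₑ ^ (2 : ℝ) := h₁.enorm.pow_const _
  have hF₂ : Measurable fun x => ‖f₂ x‖ₑ ^ (2 : ℝ) := h₂.enorm.pow_const _
  rw [lintegral_lintegral_swap ((hm1.enorm.mul hm2.enorm).pow_const _).aemeasurable]
  -- Translating `z` by `-x` frees `f₁` of `x` and leaves `f₂` at `-x + λx^⊥ + z`, a similarity in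
  -- `x` that is nondegenerate even for `λ = 0`.
  have e1 : ∀ p : ℝ × Plane,
      ∫⁻ z, (‖f₁ (p.2 + z)‖ₑ * ‖f₂ (p.1 • perp p.2 + z)‖ₑ) ^ (2 : ℝ) =
        ∫⁻ z, ‖f₁ z‖ₑ ^ (2 : ℝ) * ‖f₂ (shear (-1) p.1 p.2 + z)‖ₑ ^ (2 : ℝ) := by
    intro p
    rw [← lintegral_add_left_eq_self (μ := volume)
      (fun z => ‖f₁ z‖ₑ ^ (2 : ℝ) * ‖f₂ (shear (-1) p.1 p.2 + z)‖ₑ ^ (2 : ℝ)) p.2]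
    refine lintegral_congr fun z => ?_
    rw [ENNReal.mul_rpow_of_nonneg _ _ (by norm_num)]
    congr 4
    rw [shear_apply]; module
  simp only [e1]
  have hm3 : Measurable fun q : (ℝ × Plane) × Plane => shear (-1) q.1.1 q.1.2 + q.2 := by
    simp only [shear_apply]
    exact ((measurable_fst.snd.const_smul (-1 : ℝ)).add hp).add measurable_snd
  have hm4 : Measurable fun q : (ℝ × Plane) × Plane =>
      ‖f₁ q.2‖ₑ ^ (2 : ℝ) * ‖f₂ (shear (-1) q.1.1 q.1.2 + q.2)‖ₑ ^ (2 : ℝ) :=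
    (hF₁.comp measurable_snd).mul (hF₂.comp hm3)
  rw [Measure.volume_eq_prod, lintegral_prod _ hm4.lintegral_prod_right'.aemeasurable]
  have e2 : ∀ l : ℝ, ∫⁻ x : Plane, ∫⁻ z : Plane,
      ‖f₁ z‖ₑ ^ (2 : ℝ) * ‖f₂ (shear (-1) l x + z)‖ₑ ^ (2 : ℝ) =
        ENNReal.ofReal (1 + l ^ 2)⁻¹ * (sqNorm f₁ * sqNorm f₂) := by
    intro l
    have hm5 : Measurable fun q : Plane × Plane =>
        ‖f₁ q.2‖ₑ ^ (2 : ℝ) * ‖f₂ (shear (-1) l q.1 + q.2)‖ₑ ^ (2 : ℝ) :=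
      hm4.comp ((measurable_const.prodMk measurable_fst).prodMk measurable_snd)
    rw [lintegral_lintegral_swap hm5.aemeasurable]
    have e3 : ∀ z : Plane, ∫⁻ x : Plane,
        ‖f₁ z‖ₑ ^ (2 : ℝ) * ‖f₂ (shear (-1) l x + z)‖ₑ ^ (2 : ℝ) =
          ‖f₁ z‖ₑ ^ (2 : ℝ) * (ENNReal.ofReal (1 + l ^ 2)⁻¹ * sqNorm f₂) := by
      intro z
      have hm6 : Measurable fun x : Plane => ‖f₂ (shear (-1) l x + z)‖ₑ ^ (2 : ℝ) :=
        hF₂.comp ((continuous_shear _ _).measurable.add_const z)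
      rw [lintegral_const_mul _ hm6,
        lintegral_shear (by positivity) hF₂, sqNorm]
      norm_num
    simp only [e3]
    rw [lintegral_mul_const _ hF₁, ← sqNorm]
    ring
  simp only [e2]
  rw [lintegral_mul_const _ (by fun_prop), lintegral_inv_one_add_sq]

theorem lintegral_third_corner (h₃ : Measurable f₃) (z : Plane) :
    ∫⁻ p : ℝ × Plane, ‖f₃ (p.2 + p.1 • perp p.2 + z)‖ₑ ^ (2 : ℝ) =
      ENNReal.ofReal π * sqNorm f₃ := by
  have hF : Measurable fun x => ‖f₃ x‖ₑ ^ (2 : ℝ) := h₃.enorm.pow_const _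
  have hm : Measurable fun p : ℝ × Plane => ‖f₃ (p.2 + p.1 • perp p.2 + z)‖ₑ ^ (2 : ℝ) :=
    hF.comp ((measurable_snd.add
      (measurable_fst.smul (measurable_perp.comp measurable_snd))).add_const z)
  rw [Measure.volume_eq_prod, lintegral_prod _ hm.aemeasurable]
  have e : ∀ l : ℝ, ∫⁻ x : Plane, ‖f₃ (x + l • perp x + z)‖ₑ ^ (2 : ℝ) =
      ENNReal.ofReal (1 + l ^ 2)⁻¹ * sqNorm f₃ := by
    intro l
    have := lintegral_shear (α := 1) (β := l) (by positivity) hF z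
    simpa only [shear_apply, one_smul, one_pow, sqNorm] using this
  simp only [e]
  rw [lintegral_mul_const _ (by fun_prop), lintegral_inv_one_add_sq]

theorem measurable_crAbs (h₁ : Measurable f₁) (h₂ : Measurable f₂) (h₃ : Measurable f₃) :
    Measurable (crAbs f₁ f₂ f₃) :=
  (measurable_crIntegrand h₁ h₂ h₃).enorm.lintegral_prod_left'

/-- Cauchy–Schwarz in `(λ, x)` with `f₃` alone in one factor: by `lintegral_third_corner` that
factor does not depend on `z`, so only the pair `f₁, f₂` remains to be integrated in `z`. -/
theorem lintegral_crAbs_sq_le (h₁ : Measurable f₁) (h₂ : Measurable f₂) (h₃ : Measurable f₃) :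
    ∫⁻ z, crAbs f₁ f₂ f₃ z ^ (2 : ℝ) ≤
      ENNReal.ofReal π ^ (2 : ℝ) * (sqNorm f₁ * sqNorm f₂ * sqNorm f₃) := by
  have hcs : ∀ z, crAbs f₁ f₂ f₃ z ^ (2 : ℝ) ≤
      (∫⁻ p : ℝ × Plane, (‖f₁ (p.2 + z)‖ₑ * ‖f₂ (p.1 • perp p.2 + z)‖ₑ) ^ (2 : ℝ)) *
        (ENNReal.ofReal π * sqNorm f₃) := by
    intro z
    have hp : Measurable fun p : ℝ × Plane => p.1 • perp p.2 :=
      measurable_fst.smul (measurable_perp.comp measurable_snd)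
    have := ENNReal.lintegral_mul_le_Lp_mul_Lq (volume : Measure (ℝ × Plane))
      (Real.HolderConjugate.two_two)
      (f := fun p => ‖f₁ (p.2 + z)‖ₑ * ‖f₂ (p.1 • perp p.2 + z)‖ₑ)
      (g := fun p => ‖f₃ (p.2 + p.1 • perp p.2 + z)‖ₑ)
      ((h₁.comp (measurable_snd.add_const z)).enorm.mul
        (h₂.comp (hp.add_const z)).enorm).aemeasurable
      (h₃.comp ((measurable_snd.add hp).add_const z)).enorm.aemeasurable
    rw [lintegral_third_corner h₃] at this
    have e : crAbs f₁ f₂ f₃ z = ∫⁻ p : ℝ × Plane,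
        ((fun p : ℝ × Plane => ‖f₁ (p.2 + z)‖ₑ * ‖f₂ (p.1 • perp p.2 + z)‖ₑ) *
          fun p : ℝ × Plane => ‖f₃ (p.2 + p.1 • perp p.2 + z)‖ₑ) p := by
      refine lintegral_congr fun p => ?_
      simp only [crIntegrand, Pi.mul_apply, enorm_mul, RCLike.enorm_conj]
    rw [e]
    refine (ENNReal.rpow_le_rpow this (by norm_num)).trans_eq ?_
    rw [← ENNReal.mul_rpow_of_nonneg _ _ (by norm_num), ← ENNReal.rpow_mul]
    norm_num
  have hm : Measurable fun z => ∫⁻ p : ℝ × Plane,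
      (‖f₁ (p.2 + z)‖ₑ * ‖f₂ (p.1 • perp p.2 + z)‖ₑ) ^ (2 : ℝ) := by
    have hp : Measurable fun q : (ℝ × Plane) × Plane => q.1.1 • perp q.1.2 :=
      measurable_fst.fst.smul (measurable_perp.comp measurable_fst.snd)
    exact (((h₁.comp (measurable_fst.snd.add measurable_snd)).enorm.mul
      (h₂.comp (hp.add measurable_snd)).enorm).pow_const _).lintegral_prod_left'
  refine (lintegral_mono hcs).trans_eq ?_
  rw [lintegral_mul_const _ hm, lintegral_diagonal_pair h₁ h₂, ENNReal.rpow_two]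
  ring

theorem sqNorm_rpow_half (f : Plane → ℂ) : sqNorm f ^ (1 / 2 : ℝ) = eLpNorm f 2 volume := by
  rw [eLpNorm_eq_lintegral_rpow_enorm_toReal (by norm_num) (by norm_num)]; simp [sqNorm]

theorem sqNorm_lt_top {f : Plane → ℂ} (hf : MemLp f 2) : sqNorm f < ⊤ := by
  have := hf.2
  rw [← sqNorm_rpow_half] at this
  exact (ENNReal.rpow_lt_top_iff_of_pos (by norm_num)).1 this

theorem eLpNorm_crAbs_le (h₁ : Measurable f₁) (h₂ : Measurable f₂) (h₃ : Measurable f₃) :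
    (∫⁻ z, crAbs f₁ f₂ f₃ z ^ (2 : ℝ)) ^ (1 / 2 : ℝ) ≤ ENNReal.ofReal π *
      (eLpNorm f₁ 2 volume * eLpNorm f₂ 2 volume * eLpNorm f₃ 2 volume) := by
  refine (ENNReal.rpow_le_rpow (lintegral_crAbs_sq_le h₁ h₂ h₃) (by norm_num)).trans_eq ?_
  rw [ENNReal.mul_rpow_of_nonneg _ _ (by norm_num), ENNReal.mul_rpow_of_nonneg _ _ (by norm_num),
    ENNReal.mul_rpow_of_nonneg _ _ (by norm_num), sqNorm_rpow_half, sqNorm_rpow_half,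
    sqNorm_rpow_half, ← ENNReal.rpow_mul]
  norm_num

theorem ae_integrable_crIntegrand (h₁ : Measurable f₁) (h₂ : Measurable f₂) (h₃ : Measurable f₃)
    (m₁ : MemLp f₁ 2) (m₂ : MemLp f₂ 2) (m₃ : MemLp f₃ 2) :
    ∀ᵐ z : Plane, Integrable (fun p : ℝ × Plane => crIntegrand f₁ f₂ f₃ p.1 p.2 z) := by
  have hfin : ∫⁻ z, crAbs f₁ f₂ f₃ z ^ (2 : ℝ) ≠ ⊤ := by
    refine ((lintegral_crAbs_sq_le h₁ h₂ h₃).trans_lt ?_).ne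
    exact ENNReal.mul_lt_top (by rw [ENNReal.rpow_two]; exact ENNReal.pow_lt_top ENNReal.ofReal_lt_top)
      (ENNReal.mul_lt_top (ENNReal.mul_lt_top (sqNorm_lt_top m₁) (sqNorm_lt_top m₂))
        (sqNorm_lt_top m₃))
  filter_upwards [ae_lt_top ((measurable_crAbs h₁ h₂ h₃).pow_const _) hfin] with z hz
  refine ⟨?_, ?_⟩
  · exact ((measurable_crIntegrand h₁ h₂ h₃).comp
      (measurable_id.prodMk measurable_const)).aestronglyMeasurable
  · exact (ENNReal.rpow_lt_top_iff_of_pos (by norm_num)).1 hz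

theorem integrable_crIntegrand_mul (h₁ : Measurable f₁) (h₂ : Measurable f₂) (h₃ : Measurable f₃)
    (h₄ : Measurable f₄) (m₁ : MemLp f₁ 2) (m₂ : MemLp f₂ 2) (m₃ : MemLp f₃ 2) (m₄ : MemLp f₄ 2) :
    Integrable (fun q : (ℝ × Plane) × Plane =>
      crIntegrand f₁ f₂ f₃ q.1.1 q.1.2 q.2 * conj (f₄ q.2)) := by
  have hm : Measurable (fun q : (ℝ × Plane) × Plane =>
      crIntegrand f₁ f₂ f₃ q.1.1 q.1.2 q.2 * conj (f₄ q.2)) :=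
    (measurable_crIntegrand h₁ h₂ h₃).mul
      (Complex.continuous_conj.measurable.comp (h₄.comp measurable_snd))
  refine ⟨hm.aestronglyMeasurable, ?_⟩
  rw [hasFiniteIntegral_iff_enorm, Measure.volume_eq_prod,
    lintegral_prod_symm _ hm.enorm.aemeasurable]
  have e : ∀ z, ∫⁻ p : ℝ × Plane, ‖crIntegrand f₁ f₂ f₃ p.1 p.2 z * conj (f₄ z)‖ₑ =
      crAbs f₁ f₂ f₃ z * ‖f₄ z‖ₑ := by
    intro z
    simp only [enorm_mul, RCLike.enorm_conj]
    rw [lintegral_mul_const, crAbs]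
    exact ((measurable_crIntegrand h₁ h₂ h₃).comp
      (measurable_id.prodMk measurable_const)).enorm
  simp only [e]
  have := ENNReal.lintegral_mul_le_Lp_mul_Lq (volume : Measure Plane) Real.HolderConjugate.two_two
    (measurable_crAbs h₁ h₂ h₃).aemeasurable h₄.enorm.aemeasurable
  refine this.trans_lt (ENNReal.mul_lt_top ?_ ?_)
  · refine (eLpNorm_crAbs_le h₁ h₂ h₃).trans_lt (ENNReal.mul_lt_top ENNReal.ofReal_lt_top ?_)
    exact ENNReal.mul_lt_top (ENNReal.mul_lt_top m₁.2 m₂.2) m₃.2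
  · have := sqNorm_rpow_half f₄
    rw [sqNorm] at this
    rw [this]; exact m₄.2

theorem measurable_crT (h₁ : Measurable f₁) (h₂ : Measurable f₂) (h₃ : Measurable f₃) :
    StronglyMeasurable (crT f₁ f₂ f₃) := by
  set F : (Plane × ℝ) × Plane → ℂ := fun q => crIntegrand f₁ f₂ f₃ q.1.2 q.2 q.1.1 with hF
  have h : StronglyMeasurable F := by
    have hm : Measurable fun q : (Plane × ℝ) × Plane => ((q.1.2, q.2), q.1.1) :=
      (measurable_fst.snd.prodMk measurable_snd).prodMk measurable_fst.fst
    exact ((measurable_crIntegrand h₁ h₂ h₃).comp hm).stronglyMeasurable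
  have h' : StronglyMeasurable fun q : Plane × ℝ => ∫ x, F (q, x) := h.integral_prod_right'
  set G : Plane × ℝ → ℂ := fun q => ∫ x, F (q, x)
  have h'' : StronglyMeasurable fun z : Plane => ∫ l, G (z, l) := h'.integral_prod_right'
  have e : crT f₁ f₂ f₃ = fun z : Plane => ∫ l, ∫ x, F ((z, l), x) := by
    funext z; simp only [crT, hF]
  rw [e]
  exact h''

theorem enorm_crT_le (h₁ : Measurable f₁) (h₂ : Measurable f₂) (h₃ : Measurable f₃) (z : Plane) :
    ‖crT f₁ f₂ f₃ z‖ₑ ≤ crAbs f₁ f₂ f₃ z := by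
  have h0 : Measurable fun p : ℝ × Plane => (p, z) := measurable_id.prodMk measurable_const
  have hm : Measurable fun p : ℝ × Plane => ‖crIntegrand f₁ f₂ f₃ p.1 p.2 z‖ₑ :=
    ((measurable_crIntegrand h₁ h₂ h₃).comp h0).enorm
  have e : crAbs f₁ f₂ f₃ z = ∫⁻ l : ℝ, ∫⁻ x : Plane, ‖crIntegrand f₁ f₂ f₃ l x z‖ₑ :=
    lintegral_prod _ hm.aemeasurable
  calc ‖crT f₁ f₂ f₃ z‖ₑ ≤ ∫⁻ l : ℝ, ‖∫ x : Plane, crIntegrand f₁ f₂ f₃ l x z‖ₑ :=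
        enorm_integral_le_lintegral_enorm _
    _ ≤ ∫⁻ l : ℝ, ∫⁻ x : Plane, ‖crIntegrand f₁ f₂ f₃ l x z‖ₑ :=
        lintegral_mono fun l => enorm_integral_le_lintegral_enorm _
    _ = crAbs f₁ f₂ f₃ z := e.symm

theorem eLpNorm_crT_le (h₁ : Measurable f₁) (h₂ : Measurable f₂) (h₃ : Measurable f₃) :
    eLpNorm (crT f₁ f₂ f₃) 2 volume ≤ ENNReal.ofReal π *
      (eLpNorm f₁ 2 volume * eLpNorm f₂ 2 volume * eLpNorm f₃ 2 volume) := by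
  refine le_trans ?_ (eLpNorm_crAbs_le h₁ h₂ h₃)
  rw [eLpNorm_eq_lintegral_rpow_enorm_toReal (by norm_num) (by norm_num)]
  simp only [ENNReal.toReal_ofNat]
  exact ENNReal.rpow_le_rpow (lintegral_mono fun z =>
    ENNReal.rpow_le_rpow (enorm_crT_le h₁ h₂ h₃ z) (by norm_num)) (by norm_num)

theorem memLp_crT (h₁ : Measurable f₁) (h₂ : Measurable f₂) (h₃ : Measurable f₃)
    (m₁ : MemLp f₁ 2) (m₂ : MemLp f₂ 2) (m₃ : MemLp f₃ 2) : MemLp (crT f₁ f₂ f₃) 2 :=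
  ⟨(measurable_crT h₁ h₂ h₃).aestronglyMeasurable, (eLpNorm_crT_le h₁ h₂ h₃).trans_lt
    (ENNReal.mul_lt_top ENNReal.ofReal_lt_top
      (ENNReal.mul_lt_top (ENNReal.mul_lt_top m₁.2 m₂.2) m₃.2))⟩

theorem crT_congr (h₁ : f₁ =ᵐ[volume] g₁) (h₂ : f₂ =ᵐ[volume] g₂) (h₃ : f₃ =ᵐ[volume] g₃) :
    crT f₁ f₂ f₃ = crT g₁ g₂ g₃ := by
  funext z
  unfold crT
  -- At `λ = 0` the second function is evaluated at the single point `z`, where almost-everywhere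
  -- equality says nothing.
  have hl : ∀ᵐ l : ℝ, l ≠ 0 := by simp [ae_iff]
  refine integral_congr_ae ?_
  filter_upwards [hl] with l hl
  refine integral_congr_ae ?_
  have q₁ := (quasiMeasurePreserving_shear (α := 1) (β := 0) (by norm_num) z).ae_eq_comp h₁
  have q₂ := (quasiMeasurePreserving_shear (α := 0) (β := l) (by positivity) z).ae_eq_comp h₂
  have q₃ := (quasiMeasurePreserving_shear (α := 1) (β := l) (by positivity) z).ae_eq_comp h₃
  filter_upwards [q₁, q₂, q₃] with x e₁ e₂ e₃
  simp only [Function.comp_apply, shear_apply, one_smul, zero_smul, add_zero, zero_add]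
    at e₁ e₂ e₃
  rw [crIntegrand, crIntegrand, e₁, e₂, e₃]

theorem crT_eq_integral_prod (h : Integrable (fun p : ℝ × Plane => crIntegrand f₁ f₂ f₃ p.1 p.2 z)) :
    crT f₁ f₂ f₃ z = ∫ p : ℝ × Plane, crIntegrand f₁ f₂ f₃ p.1 p.2 z := by
  rw [Measure.volume_eq_prod] at h ⊢
  exact (integral_prod _ h).symm

/-! ### The trilinear operator on `L²` -/

theorem measurable_L2 (f : L2) : Measurable f := (Lp.stronglyMeasurable f).measurable

theorem memLp_crT_L2 (f₁ f₂ f₃ : L2) : MemLp (crT f₁ f₂ f₃) 2 :=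
  memLp_crT (measurable_L2 _) (measurable_L2 _) (measurable_L2 _) (Lp.memLp _) (Lp.memLp _)
    (Lp.memLp _)

/-- The trilinear operator as an element of `L²`. -/
def trilin (f₁ f₂ f₃ : L2) : L2 := (memLp_crT_L2 f₁ f₂ f₃).toLp (crT f₁ f₂ f₃)

theorem norm_trilin_le (f₁ f₂ f₃ : L2) : ‖trilin f₁ f₂ f₃‖ ≤ π * (‖f₁‖ * ‖f₂‖ * ‖f₃‖) := by
  have h := eLpNorm_crT_le (measurable_L2 f₁) (measurable_L2 f₂) (measurable_L2 f₃)
  rw [trilin, Lp.norm_toLp, Lp.norm_def, Lp.norm_def, Lp.norm_def, ← ENNReal.toReal_mul,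
    ← ENNReal.toReal_mul, ← ENNReal.toReal_ofReal pi_pos.le, ← ENNReal.toReal_mul]
  refine (ENNReal.toReal_le_toReal (memLp_crT_L2 f₁ f₂ f₃).2.ne ?_).2 h
  exact (ENNReal.mul_lt_top ENNReal.ofReal_lt_top (ENNReal.mul_lt_top
    (ENNReal.mul_lt_top (Lp.eLpNorm_lt_top _) (Lp.eLpNorm_lt_top _)) (Lp.eLpNorm_lt_top _))).ne

theorem trilin_ae (f₁ f₂ f₃ : L2) : ⇑(trilin f₁ f₂ f₃) =ᵐ[volume] fun z =>
    ∫ p : ℝ × Plane, crIntegrand f₁ f₂ f₃ p.1 p.2 z := by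
  filter_upwards [(memLp_crT_L2 f₁ f₂ f₃).coeFn_toLp, ae_integrable_crIntegrand (measurable_L2 f₁)
    (measurable_L2 f₂) (measurable_L2 f₃) (Lp.memLp f₁) (Lp.memLp f₂) (Lp.memLp f₃)] with z h1 h2
  rw [trilin, h1, crT_eq_integral_prod h2]

theorem ae_integrable_L2 (f₁ f₂ f₃ : L2) :
    ∀ᵐ z : Plane, Integrable (fun p : ℝ × Plane => crIntegrand f₁ f₂ f₃ p.1 p.2 z) :=
  ae_integrable_crIntegrand (measurable_L2 f₁) (measurable_L2 f₂) (measurable_L2 f₃)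
    (Lp.memLp f₁) (Lp.memLp f₂) (Lp.memLp f₃)

/-- Lets `trilin` be computed from any convenient representatives, such as pointwise sums and
multiples. -/
theorem trilin_ext {f₁ f₂ f₃ g : L2} (h₁ : f₁ =ᵐ[volume] g₁) (h₂ : f₂ =ᵐ[volume] g₂)
    (h₃ : f₃ =ᵐ[volume] g₃) (h : crT g₁ g₂ g₃ =ᵐ[volume] g) : trilin f₁ f₂ f₃ = g := by
  refine Lp.ext ?_
  filter_upwards [(memLp_crT_L2 f₁ f₂ f₃).coeFn_toLp, h] with z h1 h2
  rw [trilin, h1, crT_congr h₁ h₂ h₃, h2]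

theorem trilin_add_left (f f' f₂ f₃ : L2) :
    trilin (f + f') f₂ f₃ = trilin f f₂ f₃ + trilin f' f₂ f₃ := by
  refine trilin_ext (Lp.coeFn_add f f') .rfl .rfl ?_
  filter_upwards [Lp.coeFn_add (trilin f f₂ f₃) (trilin f' f₂ f₃), trilin_ae f f₂ f₃,
    trilin_ae f' f₂ f₃, ae_integrable_L2 f f₂ f₃, ae_integrable_L2 f' f₂ f₃] with z h h1 h2 i1 i2
  have e : (fun p : ℝ × Plane => crIntegrand (⇑f + ⇑f') f₂ f₃ p.1 p.2 z) = fun p =>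
      crIntegrand f f₂ f₃ p.1 p.2 z + crIntegrand f' f₂ f₃ p.1 p.2 z := by
    funext p; simp [crIntegrand]; ring
  rw [h, Pi.add_apply, h1, h2, crT_eq_integral_prod (by rw [e]; exact i1.add i2), e,
    integral_add i1 i2]

theorem trilin_add_mid (f f' f₁ f₃ : L2) :
    trilin f₁ (f + f') f₃ = trilin f₁ f f₃ + trilin f₁ f' f₃ := by
  refine trilin_ext .rfl (Lp.coeFn_add f f') .rfl ?_
  filter_upwards [Lp.coeFn_add (trilin f₁ f f₃) (trilin f₁ f' f₃), trilin_ae f₁ f f₃,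
    trilin_ae f₁ f' f₃, ae_integrable_L2 f₁ f f₃, ae_integrable_L2 f₁ f' f₃] with z h h1 h2 i1 i2
  have e : (fun p : ℝ × Plane => crIntegrand f₁ (⇑f + ⇑f') f₃ p.1 p.2 z) = fun p =>
      crIntegrand f₁ f f₃ p.1 p.2 z + crIntegrand f₁ f' f₃ p.1 p.2 z := by
    funext p; simp [crIntegrand]; ring
  rw [h, Pi.add_apply, h1, h2, crT_eq_integral_prod (by rw [e]; exact i1.add i2), e,
    integral_add i1 i2]

theorem trilin_add_right (f f' f₁ f₂ : L2) :
    trilin f₁ f₂ (f + f') = trilin f₁ f₂ f + trilin f₁ f₂ f' := by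
  refine trilin_ext .rfl .rfl (Lp.coeFn_add f f') ?_
  filter_upwards [Lp.coeFn_add (trilin f₁ f₂ f) (trilin f₁ f₂ f'), trilin_ae f₁ f₂ f,
    trilin_ae f₁ f₂ f', ae_integrable_L2 f₁ f₂ f, ae_integrable_L2 f₁ f₂ f'] with z h h1 h2 i1 i2
  have e : (fun p : ℝ × Plane => crIntegrand f₁ f₂ (⇑f + ⇑f') p.1 p.2 z) = fun p =>
      crIntegrand f₁ f₂ f p.1 p.2 z + crIntegrand f₁ f₂ f' p.1 p.2 z := by
    funext p; simp [crIntegrand]; ring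
  rw [h, Pi.add_apply, h1, h2, crT_eq_integral_prod (by rw [e]; exact i1.add i2), e,
    integral_add i1 i2]

theorem crT_smul (c₁ c₂ c₃ : ℂ) (z : Plane) :
    crT (c₁ • f₁) (c₂ • f₂) (c₃ • f₃) z = (c₁ * c₂ * conj c₃) * crT f₁ f₂ f₃ z := by
  simp only [crT, ← integral_const_mul]
  congr 1; funext l; congr 1; funext x
  simp [crIntegrand]; ring

theorem trilin_smul (c₁ c₂ c₃ : ℂ) (f₁ f₂ f₃ : L2) :
    trilin (c₁ • f₁) (c₂ • f₂) (c₃ • f₃) = (c₁ * c₂ * conj c₃) • trilin f₁ f₂ f₃ := by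
  refine trilin_ext (Lp.coeFn_smul c₁ f₁) (Lp.coeFn_smul c₂ f₂) (Lp.coeFn_smul c₃ f₃) ?_
  filter_upwards [Lp.coeFn_smul (c₁ * c₂ * conj c₃) (trilin f₁ f₂ f₃),
    (memLp_crT_L2 f₁ f₂ f₃).coeFn_toLp] with z h h1
  rw [crT_smul, h, Pi.smul_apply, trilin, h1, smul_eq_mul]

theorem inner_trilin (f₁ f₂ f₃ f₄ : L2) :
    inner ℂ f₄ (trilin f₁ f₂ f₃) = crE f₁ f₂ f₃ f₄ := by
  rw [L2.inner_def, crE]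
  refine integral_congr_ae ?_
  filter_upwards [(memLp_crT_L2 f₁ f₂ f₃).coeFn_toLp] with z h
  rw [RCLike.inner_apply, trilin, h]

/-- The trilinear operator as a continuous `ℝ`-multilinear map. -/
def trilinMap : ContinuousMultilinearMap ℝ (fun _ : Fin 3 => L2) L2 :=
  MultilinearMap.mkContinuous
    { toFun := fun f => trilin (f 0) (f 1) (f 2)
      map_update_add' := by
        intro inst m i x y
        obtain rfl : inst = instDecidableEqFin 3 := Subsingleton.elim _ _
        fin_cases i
        · exact trilin_add_left x y (m 1) (m 2)
        · exact trilin_add_mid x y (m 0) (m 2)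
        · exact trilin_add_right x y (m 0) (m 1)
      map_update_smul' := by
        intro inst m i c x
        obtain rfl : inst = instDecidableEqFin 3 := Subsingleton.elim _ _
        have hc : ∀ v : L2, c • v = (c : ℂ) • v := fun v => (Complex.coe_smul c v).symm
        fin_cases i
        · have := trilin_smul c 1 1 x (m 1) (m 2)
          simp only [one_smul, mul_one, map_one, ← hc] at this
          exact this
        · have := trilin_smul 1 c 1 (m 0) x (m 2)
          simp only [one_smul, mul_one, one_mul, map_one, ← hc] at this
          exact this
        · have := trilin_smul 1 1 c (m 0) (m 1) x
          simp only [one_smul, one_mul, Complex.conj_ofReal, ← hc] at this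
          exact this }
    π (fun f => by
      rw [Fin.prod_univ_three]; exact norm_trilin_le _ _ _)

theorem trilinMap_apply (f : Fin 3 → L2) : trilinMap f = trilin (f 0) (f 1) (f 2) := rfl

end

/-! ### Averages over the circle -/

theorem hasSum_cexp (z : ℂ) : HasSum (fun n : ℕ => z ^ n / n.factorial) (Complex.exp z) := by
  rw [Complex.exp_eq_exp_ℂ]; exact NormedSpace.expSeries_div_hasSum_exp z

theorem hasSum_mul_complex {f g : ℕ → ℂ} {a b : ℂ} (hf : HasSum f a) (hg : HasSum g b) :
    HasSum (fun p : ℕ × ℕ => f p.1 * g p.2) (a * b) :=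
  hf.mul hg (summable_mul_of_summable_norm hf.summable.norm hg.summable.norm)

theorem hasSum_exp_mul_exp (z z' : ℂ) :
    HasSum (fun p : ℕ × ℕ => z ^ p.1 / p.1.factorial * (z' ^ p.2 / p.2.factorial))
      (Complex.exp (z + z')) := by
  rw [Complex.exp_add]
  exact hasSum_mul_complex (f := fun n : ℕ => z ^ n / n.factorial)
    (g := fun n : ℕ => z' ^ n / n.factorial) (hasSum_cexp z) (hasSum_cexp z')

/-- Expand both exponentials and integrate termwise, which `|e| = 1` permits. The moment hypothesis
keeps the diagonal only, so the value is `M ∑ (αβ)ʲ/(j!)²`: it depends on `α, β` through `αβ` alone.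
-/
theorem integral_exp_add_eq_tsum {X : Type*} [MeasurableSpace X] {μ : Measure X} {w : X → ℝ}
    (hw : Integrable w μ) (hw0 : ∀ x, 0 ≤ w x) {e : X → ℂ} (he : Measurable e)
    (he1 : ∀ x, ‖e x‖ = 1) {M : ℂ}
    (h : ∀ j k : ℕ, ∫ x, (w x : ℂ) * (e x ^ j * conj (e x) ^ k) ∂μ = if j = k then M else 0)
    (α β : ℂ) :
    ∫ x, (w x : ℂ) * Complex.exp (α * e x + β * conj (e x)) ∂μ =
      ∑' p : ℕ × ℕ, (α ^ p.1 / p.1.factorial * (β ^ p.2 / p.2.factorial)) *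
        (if p.1 = p.2 then M else 0) := by
  have hsum : ∀ x, HasSum (fun p : ℕ × ℕ => (α ^ p.1 / p.1.factorial *
      (β ^ p.2 / p.2.factorial)) * ((w x : ℂ) * (e x ^ p.1 * conj (e x) ^ p.2)))
      ((w x : ℂ) * Complex.exp (α * e x + β * conj (e x))) := fun x => by
    have h1 := (hasSum_exp_mul_exp (α * e x) (β * conj (e x))).mul_left (w x : ℂ)
    have h2 : (fun p : ℕ × ℕ => (α ^ p.1 / p.1.factorial *
        (β ^ p.2 / p.2.factorial)) * ((w x : ℂ) * (e x ^ p.1 * conj (e x) ^ p.2))) =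
        fun p : ℕ × ℕ => (w x : ℂ) * ((α * e x) ^ p.1 / p.1.factorial *
          ((β * conj (e x)) ^ p.2 / p.2.factorial)) := by
      funext p; rw [mul_pow, mul_pow]; ring
    rw [h2]; exact h1
  have hconj : ∀ x, ‖conj (e x)‖ = 1 := fun x => by rw [RCLike.norm_conj, he1]
  have hn : ∀ j k : ℕ, ∀ x, ‖(w x : ℂ) * (e x ^ j * conj (e x) ^ k)‖ = w x := fun j k x => by
    rw [norm_mul, norm_mul, norm_pow, norm_pow, he1, hconj, one_pow, one_pow, mul_one, mul_one,
      Complex.norm_real, Real.norm_of_nonneg (hw0 x)]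
  have hi : ∀ j k : ℕ, Integrable (fun x => (w x : ℂ) * (e x ^ j * conj (e x) ^ k)) μ :=
    fun j k => by
    have h1 : Measurable fun x => conj (e x) := Complex.continuous_conj.measurable.comp he
    have h2 : Measurable fun x => e x ^ j * conj (e x) ^ k :=
      (he.pow_const j).mul (h1.pow_const k)
    exact hw.mono' ((Complex.continuous_ofReal.comp_aestronglyMeasurable hw.1).mul
      h2.aestronglyMeasurable) (ae_of_all _ fun x => (hn j k x).le)
  have hs : Summable fun p : ℕ × ℕ => ∫ x, ‖(α ^ p.1 / p.1.factorial *
      (β ^ p.2 / p.2.factorial)) * ((w x : ℂ) * (e x ^ p.1 * conj (e x) ^ p.2))‖ ∂μ := by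
    have e1 : ∀ p : ℕ × ℕ, ∫ x, ‖(α ^ p.1 / p.1.factorial *
      (β ^ p.2 / p.2.factorial)) * ((w x : ℂ) * (e x ^ p.1 * conj (e x) ^ p.2))‖ ∂μ =
        ‖α ^ p.1 / p.1.factorial * (β ^ p.2 / p.2.factorial)‖ * ∫ x, w x ∂μ := fun p => by
      rw [← integral_const_mul]
      refine integral_congr_ae (ae_of_all _ fun x => ?_)
      beta_reduce
      rw [norm_mul, hn]
    simp only [e1]
    exact (hasSum_exp_mul_exp α β).summable.norm.mul_right _
  have key := hasSum_integral_of_summable_integral_norm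
    (fun p : ℕ × ℕ => (hi p.1 p.2).const_mul _) hs
  simp only [fun x => (hsum x).tsum_eq] at key
  rw [← key.tsum_eq]
  refine tsum_congr fun p => ?_
  rw [← h p.1 p.2, ← integral_const_mul]

/-- The Cayley transform `(1 + i l) / (1 - i l)`. -/
def cayley (l : ℝ) : ℂ := (1 + Complex.I * l) / (1 - Complex.I * l)

theorem one_sub_I_mul_ne_zero (l : ℝ) : (1 : ℂ) - Complex.I * l ≠ 0 := by
  intro h; simpa using congrArg Complex.re h

theorem one_add_I_mul_ne_zero (l : ℝ) : (1 : ℂ) + Complex.I * l ≠ 0 := by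
  intro h; simpa using congrArg Complex.re h

theorem conj_cayley (l : ℝ) : conj (cayley l) = (cayley l)⁻¹ := by
  simp [cayley, sub_eq_add_neg]

theorem cayley_ne_zero (l : ℝ) : cayley l ≠ 0 :=
  div_ne_zero (one_add_I_mul_ne_zero l) (one_sub_I_mul_ne_zero l)

theorem norm_cayley (l : ℝ) : ‖cayley l‖ = 1 := by
  have h : (‖cayley l‖ : ℂ) ^ 2 = 1 := by
    rw [← Complex.mul_conj', conj_cayley, mul_inv_cancel₀ (cayley_ne_zero l)]
  have h2 : ‖cayley l‖ ^ 2 = 1 := by exact_mod_cast h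
  exact (pow_eq_one_iff_of_nonneg (norm_nonneg _) two_ne_zero).1 h2

theorem one_add_sq_factor (l : ℝ) :
    (1 : ℂ) + (l : ℂ) ^ 2 = (1 + Complex.I * l) * (1 - Complex.I * l) := by
  linear_combination (l : ℂ) ^ 2 * Complex.I_sq

theorem hasDerivAt_cayley (l : ℝ) :
    HasDerivAt cayley (2 * Complex.I * ((1 + l ^ 2 : ℝ) : ℂ)⁻¹ * cayley l) l := by
  have h0 : HasDerivAt (fun l : ℝ => Complex.I * (l : ℂ)) Complex.I l := by
    simpa using (Complex.ofRealCLM.hasDerivAt (x := l)).const_mul Complex.I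
  have := (h0.const_add 1).div (h0.const_sub 1) (one_sub_I_mul_ne_zero l)
  refine this.congr_deriv ?_
  have h1 := one_sub_I_mul_ne_zero l
  have h2 := one_add_I_mul_ne_zero l
  push_cast
  rw [one_add_sq_factor, cayley]
  field_simp
  ring

theorem tendsto_cayley {F : Filter ℝ} (hF : Tendsto (fun l : ℝ => |l|) F atTop) :
    Tendsto cayley F (𝓝 (-1)) := by
  have e : cayley = fun l : ℝ => -1 + 2 / (1 - Complex.I * l) := by
    funext l
    have := one_sub_I_mul_ne_zero l
    rw [cayley]; field_simp; ring
  rw [e]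
  have h : Tendsto (fun l : ℝ => (2 : ℂ) / (1 - Complex.I * l)) F (𝓝 0) := by
    rw [tendsto_zero_iff_norm_tendsto_zero]
    have hb : Tendsto (fun l : ℝ => 2 / |l|) F (𝓝 0) := hF.const_div_atTop 2
    refine squeeze_zero' (Eventually.of_forall fun _ => norm_nonneg _) ?_ hb
    filter_upwards [hF.eventually_gt_atTop 0] with l hl
    rw [norm_div]
    have h1 : |l| ≤ ‖(1 : ℂ) - Complex.I * l‖ := by
      have := Complex.abs_im_le_norm ((1 : ℂ) - Complex.I * l)
      simpa using this
    have h2 : ‖(2 : ℂ)‖ = 2 := by simp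
    rw [h2]
    gcongr
  simpa using h.const_add (-1)

theorem measurable_cayley : Measurable cayley := by
  unfold cayley; fun_prop

/-- Since `c' = 2i c/(1 + λ²)`, the integrand has the primitive `cᵐ/(2im)`, and `c → -1` at both
ends of the line. -/
theorem integral_cayley_zpow {m : ℤ} (hm : m ≠ 0) :
    ∫ l : ℝ, (((1 + l ^ 2)⁻¹ : ℝ) : ℂ) * cayley l ^ m = 0 := by
  have hmC : (m : ℂ) ≠ 0 := by exact_mod_cast hm
  have hd : ∀ l : ℝ, HasDerivAt (fun l => cayley l ^ m / (2 * Complex.I * m))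
      ((((1 + l ^ 2)⁻¹ : ℝ) : ℂ) * cayley l ^ m) l := fun l => by
    have := ((hasDerivAt_zpow m (cayley l) (Or.inl (cayley_ne_zero l))).comp l
      (hasDerivAt_cayley l)).div_const (2 * Complex.I * m)
    refine this.congr_deriv ?_
    have h1 := cayley_ne_zero l
    have h2 : ((1 + l ^ 2 : ℝ) : ℂ) ≠ 0 := by
      exact_mod_cast (by positivity : (1 + l ^ 2 : ℝ) ≠ 0)
    rw [zpow_sub_one₀ h1, Complex.ofReal_inv]
    field_simp
  have hi : Integrable fun l : ℝ => (((1 + l ^ 2)⁻¹ : ℝ) : ℂ) * cayley l ^ m := by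
    refine (integrable_inv_one_add_sq).mono' ?_ (ae_of_all _ fun l => ?_)
    · exact ((Complex.measurable_ofReal.comp (by fun_prop)).mul
        (measurable_cayley.pow_const m)).aestronglyMeasurable
    · rw [norm_mul, norm_zpow, norm_cayley, one_zpow, mul_one, Complex.norm_real,
        Real.norm_of_nonneg (by positivity)]
  have hlim : ∀ {F : Filter ℝ}, Tendsto (fun l : ℝ => |l|) F atTop →
      Tendsto (fun l => cayley l ^ m / (2 * Complex.I * m)) F
        (𝓝 ((-1) ^ m / (2 * Complex.I * m))) := fun hF =>
    ((tendsto_cayley hF).zpow₀ m (Or.inl (by norm_num))).div_const _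
  rw [integral_of_hasDerivAt_of_tendsto hd hi (hlim tendsto_abs_atBot_atTop)
    (hlim tendsto_abs_atTop_atTop), sub_self]

theorem integral_cayley_pow (j k : ℕ) :
    ∫ l : ℝ, (((1 + l ^ 2)⁻¹ : ℝ) : ℂ) * (cayley l ^ j * conj (cayley l) ^ k) =
      if j = k then (π : ℂ) else 0 := by
  have e : ∀ l, cayley l ^ j * conj (cayley l) ^ k = cayley l ^ ((j : ℤ) - k) := fun l => by
    rw [zpow_sub₀ (cayley_ne_zero l), conj_cayley, inv_pow, zpow_natCast, zpow_natCast,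
      div_eq_mul_inv]
  simp only [e]
  split_ifs with hjk
  · subst hjk
    simp only [sub_self, zpow_zero, mul_one]
    rw [integral_complex_ofReal, integral_univ_inv_one_add_sq]
  · exact integral_cayley_zpow (by omega)

/-- The factor 1 is the weight `w` of `integral_exp_add_eq_tsum`; the exponent `2t` is the square of
a phase `e^{it}`. -/
theorem integral_circle_pow (j k : ℕ) :
    ∫ t in Set.Ioc 0 (2 * π), (((1 : ℝ) : ℝ) : ℂ) * (Complex.exp (2 * t * Complex.I) ^ j *
      conj (Complex.exp (2 * t * Complex.I)) ^ k) = if j = k then (2 * π : ℂ) else 0 := by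
  have e : ∀ t : ℝ, (((1 : ℝ) : ℝ) : ℂ) * (Complex.exp (2 * t * Complex.I) ^ j *
      conj (Complex.exp (2 * t * Complex.I)) ^ k) =
        Complex.exp ((2 * ((j : ℂ) - k) * Complex.I) * t) := fun t => by
    rw [← Complex.exp_conj, ← Complex.exp_nat_mul, ← Complex.exp_nat_mul, ← Complex.exp_add]
    simp [Complex.conj_ofNat]
    ring_nf
  simp only [e]
  rw [← intervalIntegral.integral_of_le (by positivity)]
  split_ifs with hjk
  · subst hjk; simp
  · have hc : (2 * ((j : ℂ) - k) * Complex.I) ≠ 0 := by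
      have : (j : ℂ) - k ≠ 0 := sub_ne_zero.2 (by exact_mod_cast hjk)
      simp [this]
    rw [integral_exp_mul_complex hc]
    have h1 : Complex.exp ((2 * ((j : ℂ) - k) * Complex.I) * ((2 * π : ℝ) : ℂ)) = 1 := by
      rw [Complex.exp_eq_one_iff]
      exact ⟨2 * ((j : ℤ) - k), by push_cast; ring⟩
    rw [h1]; simp

/-- Both integrals are the same power series in `αβ`, with total masses `π` and `2π`; hence the
factor 2. -/
theorem integral_cayley_exp_eq {α β α' β' : ℂ} (h : α * β = α' * β') :
    2 * ∫ l : ℝ, (((1 + l ^ 2)⁻¹ : ℝ) : ℂ) * Complex.exp (α * cayley l + β * conj (cayley l)) =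
      ∫ t in Set.Ioc 0 (2 * π), Complex.exp (α' * Complex.exp (2 * t * Complex.I) +
        β' * conj (Complex.exp (2 * t * Complex.I))) := by
  have h1 := integral_exp_add_eq_tsum (μ := volume) (w := fun l : ℝ => (1 + l ^ 2)⁻¹)
    integrable_inv_one_add_sq (fun l => by positivity) measurable_cayley norm_cayley
    integral_cayley_pow α β
  have h2 := integral_exp_add_eq_tsum (μ := volume.restrict (Set.Ioc 0 (2 * π)))
    (w := fun _ : ℝ => 1) (integrable_const 1) (fun l => zero_le_one)
    (e := fun t => Complex.exp (2 * t * Complex.I)) (by fun_prop)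
    (fun t => by
      have : (2 * t * Complex.I : ℂ) = ((2 * t : ℝ) : ℂ) * Complex.I := by push_cast; ring
      rw [this, Complex.norm_exp_ofReal_mul_I]) integral_circle_pow α' β'
  simp only [Complex.ofReal_one, one_mul] at h2
  rw [h1, h2, ← tsum_mul_left]
  refine tsum_congr fun p => ?_
  split_ifs with hp
  · rw [← hp]
    have hf : (p.1.factorial : ℂ) ≠ 0 := by exact_mod_cast p.1.factorial_ne_zero
    have h3 : α ^ p.1 * β ^ p.1 = α' ^ p.1 * β' ^ p.1 := by rw [← mul_pow, h, mul_pow]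
    field_simp
    linear_combination h3
  · simp

/-! ### The generating Gaussians -/

theorem integral_gaussian_plane {b : ℝ} (hb : 0 < b) (c₀ c₁ k : ℂ) :
    ∫ x : Plane, Complex.exp (-(b * ((x 0 : ℂ) ^ 2 + (x 1 : ℂ) ^ 2)) +
      (c₀ * x 0 + c₁ * x 1) + k) = π / b * Complex.exp ((c₀ ^ 2 + c₁ ^ 2) / (4 * b) + k) := by
  rw [← (PiLp.volume_preserving_toLp (Fin 2)).integral_comp
    (MeasurableEquiv.toLp 2 _).measurableEmbedding]
  have h := GaussianFourier.integral_cexp_neg_mul_sum_add (b := (b : ℂ)) (by simpa using hb)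
    (![c₀, c₁] : Fin 2 → ℂ)
  simp only [Fin.sum_univ_two, Matrix.cons_val_zero, Matrix.cons_val_one, Fintype.card_fin] at h
  simp only [Complex.exp_add _ k, neg_mul] at h ⊢
  rw [integral_mul_const, h]
  norm_num
  ring

/-- The generating Gaussian `exp (a ⬝ x - a ⬝ a / 4 - |x|²/2)` of the Hermite functions. -/
def genFun (a : Fin 2 → ℂ) (x : Plane) : ℂ :=
  Complex.exp (dotC a x - quarterSq a) * gaussFun x

theorem genFun_smul (s : ℂ) (a : Fin 2 → ℂ) (x : Plane) :
    genFun (s • a) x = hermGen (dotC a x) (quarterSq a) s * gaussFun x := by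
  rw [genFun, dotC_smul, quarterSq_smul, hermGen]

theorem continuous_genFun : Continuous fun p : (Fin 2 → ℂ) × Plane => genFun p.1 p.2 := by
  unfold genFun dotC quarterSq gaussFun; fun_prop

theorem norm_quarterSq_le (a : Fin 2 → ℂ) : ‖quarterSq a‖ ≤ covSize a ^ 2 := by
  rw [quarterSq, norm_div, covSize]
  have h : ‖a 0 ^ 2 + a 1 ^ 2‖ ≤ ‖a 0‖ ^ 2 + ‖a 1‖ ^ 2 := by
    refine (norm_add_le _ _).trans ?_
    rw [norm_pow, norm_pow]
  have h4 : ‖(4 : ℂ)‖ = 4 := by simp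
  rw [h4]
  nlinarith [norm_nonneg (a 0), norm_nonneg (a 1), mul_nonneg (norm_nonneg (a 0)) (norm_nonneg (a 1)),
    sq_nonneg ‖a 0‖, sq_nonneg ‖a 1‖]

/-- Uniform over `covSize a ≤ R`, so one majorant serves all rotations of the covectors. -/
theorem norm_genFun_le {a : Fin 2 → ℂ} {R : ℝ} (hR : covSize a ≤ R) (x : Plane) :
    ‖genFun a x‖ ≤ Real.exp (R ^ 2) * gaussDom R x := by
  have h0 : 0 ≤ covSize a := add_nonneg (norm_nonneg _) (norm_nonneg _)
  rw [genFun, norm_mul, norm_gaussFun, Complex.norm_exp, gaussDom, ← Real.exp_add, ← Real.exp_add]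
  refine Real.exp_le_exp.2 ?_
  have h1 : (dotC a x - quarterSq a).re ≤ ‖dotC a x‖ + ‖quarterSq a‖ :=
    (Complex.re_le_norm _).trans (norm_sub_le _ _)
  have h2 := norm_dotC_le a x
  have h3 := norm_quarterSq_le a
  have h4 : covSize a ^ 2 ≤ R ^ 2 := by gcongr
  have h5 : covSize a * ‖x‖ ≤ R * ‖x‖ := by gcongr
  linarith

theorem covSize_smul_of_norm_one {s : ℂ} (hs : ‖s‖ = 1) (a : Fin 2 → ℂ) :
    covSize (s • a) = covSize a := by
  simp [covSize, hs]

theorem integral_genFun_smul (a : Fin 2 → ℂ) (n : ℕ) (x : Plane) :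
    ∫ θ in Set.Ioc 0 (2 * π), Complex.exp (-(n * θ * Complex.I)) *
      genFun (Complex.exp (θ * Complex.I) • a) x = 2 * π * hermFun a n x := by
  rw [hermFun, ← mul_assoc, ← hermPoly_eq_integral,
    ← intervalIntegral.integral_of_le (by positivity), ← intervalIntegral.integral_mul_const]
  simp only [genFun_smul, mul_assoc]

theorem hermPoly_smul (n : ℕ) (s X Y : ℂ) :
    hermPoly n (s * X) (s ^ 2 * Y) = s ^ n * hermPoly n X Y := by
  induction n using Nat.twoStepInduction with
  | zero => simp
  | one => simp
  | more n h0 h1 => rw [hermPoly_add_two, hermPoly_add_two, h0, h1]; ring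

theorem hermFun_smul (s : ℂ) (a : Fin 2 → ℂ) (n : ℕ) (x : Plane) :
    hermFun (s • a) n x = s ^ n * hermFun a n x := by
  rw [hermFun, dotC_smul, quarterSq_smul, hermPoly_smul, hermFun]; ring

theorem memLp_genFun (a : Fin 2 → ℂ) : MemLp (genFun a) 2 :=
  ((memLp_gaussDom (covSize a)).const_mul (Real.exp (covSize a ^ 2))).mono'
    (continuous_genFun.comp (continuous_const.prodMk continuous_id)).aestronglyMeasurable
    (ae_of_all _ fun x => norm_genFun_le le_rfl x)

theorem measurable_genFun (a : Fin 2 → ℂ) : Measurable (genFun a) :=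
  (continuous_genFun.comp (continuous_const.prodMk continuous_id)).measurable

theorem measurable_genFun_comp {Y : Type*} [MeasurableSpace Y] {A : Y → Fin 2 → ℂ} {p : Y → Plane}
    (hA : Measurable A) (hp : Measurable p) : Measurable fun y => genFun (A y) (p y) := by
  have h : Measurable fun y => (A y, p y) := hA.prodMk hp
  have h' := continuous_genFun.measurable
  generalize hG : (fun p : (Fin 2 → ℂ) × Plane => genFun p.1 p.2) = G at h'
  have e : (fun y => genFun (A y) (p y)) = fun y => G (A y, p y) := by rw [← hG]
  rw [e]
  exact h'.comp h

/-! ### The quartic form on the generating Gaussians -/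

/-- The four corners of the rectangles over which `𝓔` integrates. -/
def corner (j : Fin 4) (q : (ℝ × Plane) × Plane) : Plane :=
  ![q.1.2 + q.2, q.1.1 • perp q.1.2 + q.2, q.1.2 + q.1.1 • perp q.1.2 + q.2, q.2] j

theorem measurable_corner (j : Fin 4) : Measurable (corner j) := by
  have hp : Measurable fun q : (ℝ × Plane) × Plane => q.1.1 • perp q.1.2 :=
    measurable_fst.fst.smul (measurable_perp.comp measurable_fst.snd)
  fin_cases j
  · exact measurable_fst.snd.add measurable_snd
  · exact hp.add measurable_snd
  · exact (measurable_fst.snd.add hp).add measurable_snd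
  · exact measurable_snd

/-- Conjugating the last two functions beforehand removes all conjugations from the form, which
makes it holomorphic in the four covectors. -/
theorem prod_corner_eq {f : Fin 4 → Plane → ℂ} (q : (ℝ × Plane) × Plane) :
    ∏ j, f j (corner j q) = crIntegrand (f 0) (f 1) (fun x => conj (f 2 x)) q.1.1 q.1.2 q.2 *
      conj (conj (f 3 q.2)) := by
  simp [Fin.prod_univ_four, corner, crIntegrand]

theorem integrable_prod_corner {f : Fin 4 → Plane → ℂ} (hf : ∀ j, Measurable (f j))
    (hm : ∀ j, MemLp (f j) 2) : Integrable fun q => ∏ j, f j (corner j q) := by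
  simp only [prod_corner_eq]
  have hc : ∀ j, Measurable fun x => conj (f j x) := fun j =>
    Complex.continuous_conj.measurable.comp (hf j)
  exact integrable_crIntegrand_mul (f₄ := fun x => conj (f 3 x)) (hf 0) (hf 1) (hc 2) (hc 3)
    (hm 0) (hm 1) (hm 2).star (hm 3).star

/-- The four Gaussians contribute `-2|z|²`, hence `b = 2` and the factor `π/2`. Completing the
square in `z` leaves `-(1 + λ²)|x|²/2`. -/
theorem integral_genFun_fourth (a b c d : Fin 2 → ℂ) (l : ℝ) (x : Plane) :
    ∫ z : Plane, genFun a (x + z) * genFun b (l • perp x + z) * genFun c (x + l • perp x + z) *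
      genFun d z = π / 2 * Complex.exp (
        -(((1 + l ^ 2) / 2 : ℝ) * ((x 0 : ℂ) ^ 2 + (x 1 : ℂ) ^ 2)) +
        ((a 0 + l * b 1 + (c 0 + l * c 1) - (a 0 + b 0 + c 0 + d 0 + l * (a 1 + b 1 + c 1 + d 1)) / 2) * x 0
        + (a 1 - l * b 0 + (c 1 - l * c 0) - (a 1 + b 1 + c 1 + d 1 - l * (a 0 + b 0 + c 0 + d 0)) / 2) * x 1)
        + (((a 0 + b 0 + c 0 + d 0) ^ 2 + (a 1 + b 1 + c 1 + d 1) ^ 2) / 8 -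
          (quarterSq a + quarterSq b + quarterSq c + quarterSq d))) := by
  have h := integral_gaussian_plane (b := 2) two_pos
    (a 0 + b 0 + c 0 + d 0 - 2 * (x 0 - l * x 1)) (a 1 + b 1 + c 1 + d 1 - 2 * (x 1 + l * x 0))
    (dotC a x + (b 0 * (-(l * x 1)) + b 1 * (l * x 0)) +
      (c 0 * (x 0 - l * x 1) + c 1 * (x 1 + l * x 0))
      - ((x 0 - l * x 1 : ℂ) ^ 2 + (x 1 + l * x 0 : ℂ) ^ 2) -
          (quarterSq a + quarterSq b + quarterSq c + quarterSq d))
  refine Eq.trans (integral_congr_ae (ae_of_all _ fun z => ?_)) (h.trans ?_)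
  · simp only [genFun, gaussFun, ← Complex.exp_add]
    congr 1
    simp [dotC, perp]
    ring
  · push_cast
    congr 2
    simp only [dotC]
    ring

/-- The `x`-integral has `b = (1 + λ²)/2` and supplies the Cauchy weight. With `p = a - b` and `q =
c - d`, the `λ`-dependence of the exponent is carried by `p ⬝ q` and `p × q`, multiplied by the real
and imaginary parts of `cayley l`. -/
theorem integral_genFun_fourth_third (a b c d : Fin 2 → ℂ) (l : ℝ) :
    ∫ x : Plane, ∫ z : Plane, genFun a (x + z) * genFun b (l • perp x + z) *
      genFun c (x + l • perp x + z) * genFun d z =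
    π ^ 2 * Complex.exp (((a 0 + b 0) * (c 0 + d 0) + (a 1 + b 1) * (c 1 + d 1)) / 4) *
      ((((1 + l ^ 2)⁻¹ : ℝ) : ℂ) * Complex.exp (
        (((a 0 - b 0) * (c 0 - d 0) + (a 1 - b 1) * (c 1 - d 1)) - Complex.I *
          ((a 0 - b 0) * (c 1 - d 1) - (a 1 - b 1) * (c 0 - d 0))) / 8 * cayley l +
        (((a 0 - b 0) * (c 0 - d 0) + (a 1 - b 1) * (c 1 - d 1)) + Complex.I *
          ((a 0 - b 0) * (c 1 - d 1) - (a 1 - b 1) * (c 0 - d 0))) / 8 * conj (cayley l))) := by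
  simp only [integral_genFun_fourth]
  rw [integral_const_mul, integral_gaussian_plane (by positivity)]
  have hl : (1 : ℂ) + (l : ℂ) ^ 2 ≠ 0 := by
    exact_mod_cast (by positivity : (1 + l ^ 2 : ℝ) ≠ 0)
  have h1 : cayley l = (1 - l ^ 2 + 2 * Complex.I * l) / (1 + l ^ 2) := by
    have := one_sub_I_mul_ne_zero l
    have := one_add_I_mul_ne_zero l
    rw [cayley, one_add_sq_factor]
    field_simp
    linear_combination (l : ℂ) ^ 2 * Complex.I_sq
  have h2 : conj (cayley l) = (1 - l ^ 2 - 2 * Complex.I * l) / (1 + l ^ 2) := by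
    rw [h1]; simp [Complex.conj_ofNat, sub_eq_add_neg]
  -- Here `s` stands for `p ⬝ q` and `w` for `p × q`.
  have h3 : ∀ s w : ℂ, (s - Complex.I * w) / 8 * cayley l + (s + Complex.I * w) / 8 * conj (cayley l)
      = ((1 - l ^ 2) * s + 2 * l * w) / (4 * (1 + l ^ 2)) := fun s w => by
    rw [h2, h1]
    field_simp
    linear_combination (-16 * (l : ℂ) * w) * Complex.I_sq
  have h4 : ∀ e₁ e₂ e₃ : ℂ, e₁ = e₂ + e₃ →
      (π : ℂ) / 2 * (π / ((1 + (l : ℂ) ^ 2) / 2) * Complex.exp e₁) =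
        π ^ 2 * Complex.exp e₂ * ((1 + (l : ℂ) ^ 2)⁻¹ * Complex.exp e₃) := fun e₁ e₂ e₃ h => by
    rw [h, Complex.exp_add]; field_simp
  rw [h3]
  push_cast
  refine h4 _ _ _ ?_
  simp only [quarterSq]
  field_simp
  ring

theorem integral_prod_genFun (v : Fin 4 → Fin 2 → ℂ) :
    ∫ x : Plane, ∏ j, genFun (v j) x = π / 2 * Complex.exp (
      ((v 0 0 + v 1 0 + v 2 0 + v 3 0) ^ 2 + (v 0 1 + v 1 1 + v 2 1 + v 3 1) ^ 2) / 8 -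
        (quarterSq (v 0) + quarterSq (v 1) + quarterSq (v 2) + quarterSq (v 3))) := by
  have h := integral_gaussian_plane (b := 2) two_pos (v 0 0 + v 1 0 + v 2 0 + v 3 0)
    (v 0 1 + v 1 1 + v 2 1 + v 3 1)
    (-(quarterSq (v 0) + quarterSq (v 1) + quarterSq (v 2) + quarterSq (v 3)))
  refine Eq.trans (integral_congr_ae (ae_of_all _ fun x => ?_)) (h.trans ?_)
  · simp only [Fin.prod_univ_four, genFun, gaussFun, ← Complex.exp_add]
    congr 1
    simp [dotC]
    ring
  · push_cast
    congr 2
    ring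

/-- The phases by which the Schrödinger flow acts on the four functions. -/
def phase (j : Fin 4) (t : ℝ) : ℂ :=
  ![Complex.exp (t * Complex.I), Complex.exp (t * Complex.I), conj (Complex.exp (t * Complex.I)),
    conj (Complex.exp (t * Complex.I))] j

theorem norm_phase (j : Fin 4) (t : ℝ) : ‖phase j t‖ = 1 := by
  fin_cases j <;> simp [phase, Complex.norm_exp_ofReal_mul_I]

theorem continuous_phase (j : Fin 4) : Continuous (phase j) := by
  have h : Continuous fun t : ℝ => Complex.exp (t * Complex.I) := by fun_prop
  fin_cases j
  · exact h
  · exact h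
  · exact Complex.continuous_conj.comp h
  · exact Complex.continuous_conj.comp h

/-- Cross terms between the two pairs have phase `e^{it} e^{-it} = 1`. Inside a pair the exponent is
`(a + b)²/8 - (a² + b²)/4 = -(a - b)²/8`, with phase `e^{±2it}`. -/
theorem integral_prod_genFun_phase (v : Fin 4 → Fin 2 → ℂ) (t : ℝ) :
    ∫ x : Plane, ∏ j, genFun (phase j t • v j) x =
      π / 2 * Complex.exp (((v 0 0 + v 1 0) * (v 2 0 + v 3 0) + (v 0 1 + v 1 1) * (v 2 1 + v 3 1)) / 4) *
        Complex.exp (-((v 0 0 - v 1 0) ^ 2 + (v 0 1 - v 1 1) ^ 2) / 8 *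
            Complex.exp (2 * t * Complex.I) +
          -((v 2 0 - v 3 0) ^ 2 + (v 2 1 - v 3 1) ^ 2) / 8 *
            conj (Complex.exp (2 * t * Complex.I))) := by
  have h2 : Complex.exp (2 * t * Complex.I) = Complex.exp (t * Complex.I) ^ 2 := by
    rw [← Complex.exp_nat_mul]; congr 1; push_cast; ring
  have h1 : Complex.exp (t * Complex.I) * conj (Complex.exp (t * Complex.I)) = 1 := by
    rw [Complex.mul_conj', Complex.norm_exp_ofReal_mul_I]; simp
  rw [integral_prod_genFun, mul_assoc, ← Complex.exp_add, h2, map_pow]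
  simp only [phase, Matrix.cons_val]
  generalize Complex.exp (t * Complex.I) = E at h1
  generalize conj E = E' at h1
  congr 2
  simp only [quarterSq, Pi.smul_apply, smul_eq_mul]
  linear_combination (((v 0 0 + v 1 0) * (v 2 0 + v 3 0) + (v 0 1 + v 1 1) * (v 2 1 + v 3 1)) / 4) * h1

/-- The key identity. Both sides share the factor `exp ((a + b) ⬝ (c + d) / 4)`; what remains is
compared by `integral_cayley_exp_eq`. -/
theorem integral_prod_genFun_corner (v : Fin 4 → Fin 2 → ℂ) :
    ∫ q, ∏ j, genFun (v j) (corner j q) =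
      π * ∫ t in Set.Ioc 0 (2 * π), ∫ x : Plane, ∏ j, genFun (phase j t • v j) x := by
  have hi : Integrable fun q => ∏ j, genFun (v j) (corner j q) :=
    integrable_prod_corner (f := fun j => genFun (v j)) (fun j => measurable_genFun _)
      (fun j => memLp_genFun _)
  have e : ∫ q, ∏ j, genFun (v j) (corner j q) = ∫ l : ℝ, ∫ x : Plane, ∫ z : Plane,
      genFun (v 0) (x + z) * genFun (v 1) (l • perp x + z) * genFun (v 2) (x + l • perp x + z) *
        genFun (v 3) z := by
    rw [Measure.volume_eq_prod] at hi ⊢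
    rw [integral_prod _ hi]
    have hi2 := hi.integral_prod_left
    rw [Measure.volume_eq_prod] at hi2 ⊢
    rw [integral_prod _ hi2]
    simp [Fin.prod_univ_four, corner]
  rw [e]
  simp only [integral_genFun_fourth_third, integral_prod_genFun_phase, integral_const_mul]
  rw [← integral_cayley_exp_eq (α := (((v 0 0 - v 1 0) * (v 2 0 - v 3 0) +
    (v 0 1 - v 1 1) * (v 2 1 - v 3 1)) - Complex.I * ((v 0 0 - v 1 0) * (v 2 1 - v 3 1) -
    (v 0 1 - v 1 1) * (v 2 0 - v 3 0))) / 8) (β := (((v 0 0 - v 1 0) * (v 2 0 - v 3 0) +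
    (v 0 1 - v 1 1) * (v 2 1 - v 3 1)) + Complex.I * ((v 0 0 - v 1 0) * (v 2 1 - v 3 1) -
    (v 0 1 - v 1 1) * (v 2 0 - v 3 0))) / 8)]
  · ring
  -- Equality of the two products `αβ`: Lagrange's identity for `p` and `q`, divided by 64.
  · linear_combination (-((v 0 0 - v 1 0) * (v 2 1 - v 3 1) -
      (v 0 1 - v 1 1) * (v 2 0 - v 3 0)) ^ 2 / 64) * Complex.I_sq

/-! ### Extraction of Hermite coefficients -/

theorem norm_exp_neg_nat_mul (n : ℕ) (θ : ℝ) : ‖Complex.exp (-(n * θ * Complex.I))‖ = 1 := by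
  have : (-(n * θ * Complex.I) : ℂ) = ((-(n * θ) : ℝ) : ℂ) * Complex.I := by push_cast; ring
  rw [this, Complex.norm_exp_ofReal_mul_I]

/-- The normalised length measure on the four-dimensional torus. -/
def torus : Measure (Fin 4 → ℝ) := Measure.pi fun _ => volume.restrict (Set.Ioc 0 (2 * π))

instance : IsFiniteMeasure torus := by unfold torus; infer_instance

/-- Fubini on `X × torus`: for fixed `x` the torus integral splits into four Cauchy integrals, each
worth `2π` times a Hermite function. The covectors may vary with `x` so that the lemma also covers
the side with the phases. -/
theorem integral_prod_hermFun {X : Type*} [MeasurableSpace X] {μ : Measure X} [SFinite μ]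
    {A : Fin 4 → X → Fin 2 → ℂ} {pt : Fin 4 → X → Plane} (hA : ∀ j, Measurable (A j))
    (hpt : ∀ j, Measurable (pt j)) {R : ℝ} (hR : ∀ j x, covSize (A j x) ≤ R)
    (hB : Integrable (fun x => ∏ j, gaussDom R (pt j x)) μ) (n : Fin 4 → ℕ) :
    (2 * π) ^ 4 * ∫ x, ∏ j, hermFun (A j x) (n j) (pt j x) ∂μ =
      ∫ θ, (∏ j, Complex.exp (-(n j * θ j * Complex.I))) *
        ∫ x, ∏ j, genFun (Complex.exp (θ j * Complex.I) • A j x) (pt j x) ∂μ ∂torus := by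
  set F : X → (Fin 4 → ℝ) → ℂ := fun x θ => ∏ j, (Complex.exp (-(n j * θ j * Complex.I)) *
    genFun (Complex.exp (θ j * Complex.I) • A j x) (pt j x)) with hF
  have hFi : Integrable (Function.uncurry F) (μ.prod torus) := by
    have hdom : Integrable (fun p : X × (Fin 4 → ℝ) =>
        ∏ j, (Real.exp (R ^ 2) * gaussDom R (pt j p.1))) (μ.prod torus) := by
      simp only [Finset.prod_mul_distrib]
      exact (hB.const_mul _).comp_fst torus
    refine hdom.mono' ?_ (ae_of_all _ fun p => ?_)
    · refine (Finset.measurable_prod _ fun j _ => ?_).aestronglyMeasurable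
      have hθ : Measurable fun p : X × (Fin 4 → ℝ) => p.2 j :=
        (measurable_pi_apply j).comp measurable_snd
      have hs : Measurable fun p : X × (Fin 4 → ℝ) => Complex.exp (p.2 j * Complex.I) := by
        fun_prop
      have hsA : Measurable fun p : X × (Fin 4 → ℝ) =>
          Complex.exp (p.2 j * Complex.I) • A j p.1 := hs.smul ((hA j).comp measurable_fst)
      refine Measurable.mul (by fun_prop) ?_
      exact measurable_genFun_comp hsA ((hpt j).comp measurable_fst)
    · rw [Function.uncurry, hF]
      rw [norm_prod]
      refine Finset.prod_le_prod (fun _ _ => norm_nonneg _) fun j _ => ?_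
      rw [norm_mul, norm_exp_neg_nat_mul, one_mul]
      refine norm_genFun_le ?_ _
      rw [covSize_smul_of_norm_one (Complex.norm_exp_ofReal_mul_I _)]
      exact hR j _
  have h1 : ∀ x, ∫ θ, F x θ ∂torus = (2 * π) ^ 4 * ∏ j, hermFun (A j x) (n j) (pt j x) := by
    intro x
    rw [torus]
    refine (integral_fintype_prod_eq_prod (fun (j : Fin 4) (θ : ℝ) =>
      Complex.exp (-(n j * θ * Complex.I)) *
        genFun (Complex.exp (θ * Complex.I) • A j x) (pt j x))).trans ?_
    simp only [integral_genFun_smul]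
    simp [Finset.prod_mul_distrib]
  have h2 : ∀ θ : Fin 4 → ℝ, ∫ x, F x θ ∂μ = (∏ j, Complex.exp (-(n j * θ j * Complex.I))) *
      ∫ x, ∏ j, genFun (Complex.exp (θ j * Complex.I) • A j x) (pt j x) ∂μ := by
    intro θ
    simp only [hF, Finset.prod_mul_distrib, integral_const_mul]
  have h3 := integral_integral_swap hFi
  simp only [h1, h2, integral_const_mul] at h3
  exact h3

/-- The product of phases is `exp (i(n₁ + n₂ - n₃ - n₄)t)`: this is where resonance enters. -/
theorem integral_phase_pow (n : Fin 4 → ℕ) :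
    ∫ t in Set.Ioc 0 (2 * π), ∏ j, phase j t ^ n j =
      if n 0 + n 1 = n 2 + n 3 then (2 * π : ℂ) else 0 := by
  have e : ∀ t : ℝ, ∏ j, phase j t ^ n j =
      Complex.exp ((((n 0 + n 1 : ℕ) : ℂ) - (n 2 + n 3 : ℕ)) * Complex.I * t) := fun t => by
    simp only [Fin.prod_univ_four, phase, Matrix.cons_val, ← Complex.exp_conj,
      ← Complex.exp_nat_mul, ← Complex.exp_add]
    congr 1
    simp
    ring
  simp only [e]
  rw [← intervalIntegral.integral_of_le (by positivity)]
  split_ifs with h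
  · simp [h]
  · have hc : (((n 0 + n 1 : ℕ) : ℂ) - (n 2 + n 3 : ℕ)) * Complex.I ≠ 0 :=
      mul_ne_zero (sub_ne_zero.2 (by exact_mod_cast h)) Complex.I_ne_zero
    rw [integral_exp_mul_complex hc]
    have h1 : Complex.exp ((((n 0 + n 1 : ℕ) : ℂ) - (n 2 + n 3 : ℕ)) * Complex.I *
        ((2 * π : ℝ) : ℂ)) = 1 := by
      rw [Complex.exp_eq_one_iff]
      exact ⟨((n 0 + n 1 : ℕ) : ℤ) - (n 2 + n 3 : ℕ), by push_cast; ring⟩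
    rw [h1]; simp

theorem integrable_prod_gaussDom (R : ℝ) : Integrable fun x : Plane => ∏ _j : Fin 4, gaussDom R x := by
  have h := ((memLp_gaussDom R).integrable_mul (memLp_gaussDom R)).const_mul (Real.exp (R ^ 2) ^ 2)
  refine h.mono' ?_ (ae_of_all _ fun x => ?_)
  · exact (continuous_finsetProd _ fun _ _ => continuous_gaussDom R).aestronglyMeasurable
  · have h0 := (gaussDom_pos R x).le
    rw [Real.norm_of_nonneg (Finset.prod_nonneg fun _ _ => h0), Fin.prod_univ_four]
    have h1 := gaussDom_le R x
    calc gaussDom R x * gaussDom R x * gaussDom R x * gaussDom R x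
        = (gaussDom R x * gaussDom R x) * (gaussDom R x * gaussDom R x) := by ring
      _ ≤ (Real.exp (R ^ 2) * Real.exp (R ^ 2)) * (gaussDom R x * gaussDom R x) := by
          gcongr
      _ = _ := by rw [← sq (Real.exp _)]; rfl

/-- Taking the torus coefficient of both sides of the key identity. By homogeneity (`hermFun_smul`)
the phases leave the Hermite functions as powers, and the `t`-integral gives `π · 2π` on resonant
indices and 0 elsewhere. -/
theorem integral_prod_hermFun_corner (v : Fin 4 → Fin 2 → ℂ) (n : Fin 4 → ℕ) :
    ∫ q, ∏ j, hermFun (v j) (n j) (corner j q) =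
      if n 0 + n 1 = n 2 + n 3 then 2 * π ^ 2 * ∫ x, ∏ j, hermFun (v j) (n j) x else 0 := by
  set R : ℝ := ∑ j, covSize (v j) with hRdef
  have hnn : ∀ j, 0 ≤ covSize (v j) := fun j => add_nonneg (norm_nonneg _) (norm_nonneg _)
  have hR : ∀ j, covSize (v j) ≤ R := fun j =>
    Finset.single_le_sum (f := fun j => covSize (v j)) (fun j _ => hnn j) (Finset.mem_univ j)
  have hE := integral_prod_hermFun (μ := volume) (A := fun j (_ : (ℝ × Plane) × Plane) => v j)
    (pt := corner) (fun j => measurable_const) measurable_corner (fun j _ => hR j) (by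
      -- The majorant over the corners is integrable by the `L²` bound on `𝓔`, applied to `gaussDom`
      -- itself.
      have := (integrable_prod_corner (f := fun _ x => (gaussDom R x : ℂ))
        (fun _ => Complex.measurable_ofReal.comp (continuous_gaussDom R).measurable)
        (fun _ => (memLp_gaussDom R).ofReal)).norm
      refine this.congr (ae_of_all _ fun q => ?_)
      beta_reduce
      rw [norm_prod]
      refine Finset.prod_congr rfl fun j _ => ?_
      rw [Complex.norm_real, Real.norm_of_nonneg (gaussDom_pos _ _).le]) n
  have hQ := integral_prod_hermFun (μ := (volume.restrict (Set.Ioc 0 (2 * π))).prod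
    (volume : Measure Plane)) (A := fun j (p : ℝ × Plane) => phase j p.1 • v j)
    (pt := fun _ p => p.2)
    (fun j => ((continuous_phase j).measurable.comp measurable_fst).smul measurable_const)
    (fun _ => measurable_snd) (R := R)
    (fun j p => by rw [covSize_smul_of_norm_one (norm_phase _ _)]; exact hR j)
    ((integrable_prod_gaussDom R).comp_snd _) n
  have hswap : ∀ θ : Fin 4 → ℝ,
      ∫ q, ∏ j, genFun (Complex.exp (θ j * Complex.I) • v j) (corner j q) =
      π * ∫ p : ℝ × Plane, ∏ j, genFun (Complex.exp (θ j * Complex.I) • phase j p.1 • v j) p.2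
        ∂((volume.restrict (Set.Ioc 0 (2 * π))).prod (volume : Measure Plane)) := by
    intro θ
    rw [integral_prod_genFun_corner, integral_prod]
    · simp only [smul_comm (phase _ _)]
    · have hdom := ((integrable_prod_gaussDom R).const_mul (∏ _j : Fin 4, Real.exp (R ^ 2))).comp_snd
        (volume.restrict (Set.Ioc 0 (2 * π)))
      refine hdom.mono' ?_ (ae_of_all _ fun p => ?_)
      · refine (Finset.measurable_prod _ fun j _ => ?_).aestronglyMeasurable
        have hph : Measurable fun p : ℝ × Plane =>
            Complex.exp (θ j * Complex.I) • phase j p.1 • v j :=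
          (((continuous_phase j).measurable.comp measurable_fst).smul_const (v j)).const_smul
            (Complex.exp (θ j * Complex.I))
        exact measurable_genFun_comp hph measurable_snd
      · rw [norm_prod, ← Finset.prod_mul_distrib]
        refine Finset.prod_le_prod (fun _ _ => norm_nonneg _) fun j _ => norm_genFun_le ?_ _
        rw [covSize_smul_of_norm_one (Complex.norm_exp_ofReal_mul_I _),
          covSize_smul_of_norm_one (norm_phase _ _)]
        exact hR j
  have hpi : ((2 * π : ℂ)) ^ 4 ≠ 0 := by
    have : (π : ℂ) ≠ 0 := by exact_mod_cast pi_ne_zero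
    exact pow_ne_zero _ (mul_ne_zero two_ne_zero this)
  have hmain : ∫ q, ∏ j, hermFun (v j) (n j) (corner j q) =
      π * ∫ p : ℝ × Plane, ∏ j, hermFun (phase j p.1 • v j) (n j) p.2
        ∂((volume.restrict (Set.Ioc 0 (2 * π))).prod (volume : Measure Plane)) := by
    refine mul_left_cancel₀ hpi ?_
    rw [hE, mul_left_comm, hQ, ← integral_const_mul]
    refine integral_congr_ae (ae_of_all _ fun θ => ?_)
    beta_reduce
    rw [hswap θ]; ring
  rw [hmain]
  simp only [hermFun_smul, Finset.prod_mul_distrib]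
  rw [integral_prod_mul (μ := volume.restrict (Set.Ioc 0 (2 * π)))
    (fun t : ℝ => ∏ j, phase j t ^ n j) (fun x : Plane => ∏ j, hermFun (v j) (n j) x),
    integral_phase_pow]
  split_ifs
  · ring
  · ring

/-! ### The quartic form on the eigenspaces -/

theorem crE_congr {f₁ f₂ f₃ f₄ g₁ g₂ g₃ g₄ : Plane → ℂ} (h₁ : f₁ =ᵐ[volume] g₁)
    (h₂ : f₂ =ᵐ[volume] g₂) (h₃ : f₃ =ᵐ[volume] g₃) (h₄ : f₄ =ᵐ[volume] g₄) :
    crE f₁ f₂ f₃ f₄ = crE g₁ g₂ g₃ g₄ := by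
  unfold crE
  rw [crT_congr h₁ h₂ h₃]
  refine integral_congr_ae ?_
  filter_upwards [h₄] with z hz
  rw [hz]

theorem crE_eq_integral {f₁ f₂ f₃ f₄ : Plane → ℂ} (h₁ : Measurable f₁) (h₂ : Measurable f₂)
    (h₃ : Measurable f₃) (h₄ : Measurable f₄) (m₁ : MemLp f₁ 2) (m₂ : MemLp f₂ 2)
    (m₃ : MemLp f₃ 2) (m₄ : MemLp f₄ 2) :
    crE f₁ f₂ f₃ f₄ = ∫ q : (ℝ × Plane) × Plane,
      crIntegrand f₁ f₂ f₃ q.1.1 q.1.2 q.2 * conj (f₄ q.2) := by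
  have hi := integrable_crIntegrand_mul h₁ h₂ h₃ h₄ m₁ m₂ m₃ m₄
  rw [Measure.volume_eq_prod] at hi ⊢
  rw [integral_prod_symm _ hi, crE]
  refine integral_congr_ae ?_
  filter_upwards [ae_integrable_crIntegrand h₁ h₂ h₃ m₁ m₂ m₃] with z h
  rw [crT_eq_integral_prod h, integral_mul_const]

theorem memLp_hermFun (a : Fin 2 → ℂ) (n : ℕ) : MemLp (hermFun a n) 2 := by
  have : ⇑(hermS a n) = hermFun a n := funext (hermS_apply a n)
  rw [← this]; exact (hermS a n).memLp 2 volume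

theorem crE_hermFun (a b c d : Fin 2 → ℂ) (n₁ n₂ n₃ n₄ : ℕ) :
    crE (hermFun a n₁) (hermFun b n₂) (hermFun c n₃) (hermFun d n₄) =
      if n₁ + n₂ = n₃ + n₄ then 2 * π ^ 2 * ∫ x, hermFun a n₁ x * hermFun b n₂ x *
        conj (hermFun c n₃ x) * conj (hermFun d n₄ x) else 0 := by
  rw [crE_eq_integral (continuous_hermFun _ _).measurable (continuous_hermFun _ _).measurable
    (continuous_hermFun _ _).measurable (continuous_hermFun _ _).measurable
    (memLp_hermFun _ _) (memLp_hermFun _ _) (memLp_hermFun _ _) (memLp_hermFun _ _)]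
  have h := integral_prod_hermFun_corner ![a, b, star c, star d] ![n₁, n₂, n₃, n₄]
  have e : ∀ q : (ℝ × Plane) × Plane, ∏ j, hermFun (![a, b, star c, star d] j)
      (![n₁, n₂, n₃, n₄] j) (corner j q) = crIntegrand (hermFun a n₁) (hermFun b n₂)
        (hermFun c n₃) q.1.1 q.1.2 q.2 * conj (hermFun d n₄ q.2) := fun q => by
    simp [Fin.prod_univ_four, corner, crIntegrand, conj_hermFun]
  simp only [e] at h
  rw [h]
  simp [Fin.prod_univ_four, conj_hermFun]

/-- The integral `∫ f₁ f₂ conj f₃ conj f₄` of Schwartz functions. -/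
def quarticS (f₁ f₂ f₃ f₄ : 𝓢(Plane, ℂ)) : ℂ := ∫ x, f₁ x * f₂ x * conj (f₃ x) * conj (f₄ x)

theorem memLp_cubic (f₁ f₂ f₃ : 𝓢(Plane, ℂ)) : MemLp (fun x => f₁ x * f₂ x * conj (f₃ x)) 2 := by
  have h12 : MemLp (fun x => f₁ x * f₂ x) 2 := (f₂.memLp 2 volume).mul (f₁.memLp ⊤ volume)
  exact (f₃.memLp ⊤ volume).star.mul h12

theorem integrable_quartic (f₁ f₂ f₃ f₄ : 𝓢(Plane, ℂ)) :
    Integrable (fun x => f₁ x * f₂ x * conj (f₃ x) * conj (f₄ x)) :=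
  (memLp_cubic f₁ f₂ f₃).integrable_mul (f₄.memLp 2 volume).star

/-- The deviation of the quartic form from a multiple of the quartic integral. -/
def defect (r : ℂ) (f₁ f₂ f₃ f₄ : 𝓢(Plane, ℂ)) : ℂ :=
  inner ℂ (ofSchwartz f₄) (trilin (ofSchwartz f₁) (ofSchwartz f₂) (ofSchwartz f₃)) -
    r * quarticS f₁ f₂ f₃ f₄

theorem ofSchwartz_add (f g : 𝓢(Plane, ℂ)) : ofSchwartz (f + g) = ofSchwartz f + ofSchwartz g :=
  map_add ofSchwartzCLM f g

section

variable (r : ℂ) (f g f₁ f₂ f₃ f₄ : 𝓢(Plane, ℂ))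

theorem defect_smul (c₁ c₂ c₃ c₄ : ℂ) :
    defect r (c₁ • f₁) (c₂ • f₂) (c₃ • f₃) (c₄ • f₄) =
      c₁ * c₂ * conj c₃ * conj c₄ * defect r f₁ f₂ f₃ f₄ := by
  have hq : quarticS (c₁ • f₁) (c₂ • f₂) (c₃ • f₃) (c₄ • f₄) =
      c₁ * c₂ * conj c₃ * conj c₄ * quarticS f₁ f₂ f₃ f₄ := by
    rw [quarticS, quarticS, ← integral_const_mul]
    congr 1; funext x
    simp only [_root_.smul_apply, smul_eq_mul, map_mul]; ring
  rw [defect, defect, hq, ofSchwartz_smul, ofSchwartz_smul, ofSchwartz_smul, ofSchwartz_smul,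
    trilin_smul, inner_smul_left, inner_smul_right]
  ring

theorem defect_add_first :
    defect r (f + g) f₂ f₃ f₄ = defect r f f₂ f₃ f₄ + defect r g f₂ f₃ f₄ := by
  have hq : quarticS (f + g) f₂ f₃ f₄ = quarticS f f₂ f₃ f₄ + quarticS g f₂ f₃ f₄ := by
    rw [quarticS, quarticS, quarticS,
      ← integral_add (integrable_quartic _ _ _ _) (integrable_quartic _ _ _ _)]
    congr 1; funext x
    simp only [_root_.add_apply]; ring
  rw [defect, defect, defect, hq, ofSchwartz_add, trilin_add_left, inner_add_right]; ring

theorem defect_add_second :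
    defect r f₁ (f + g) f₃ f₄ = defect r f₁ f f₃ f₄ + defect r f₁ g f₃ f₄ := by
  have hq : quarticS f₁ (f + g) f₃ f₄ = quarticS f₁ f f₃ f₄ + quarticS f₁ g f₃ f₄ := by
    rw [quarticS, quarticS, quarticS,
      ← integral_add (integrable_quartic _ _ _ _) (integrable_quartic _ _ _ _)]
    congr 1; funext x
    simp only [_root_.add_apply]; ring
  rw [defect, defect, defect, hq, ofSchwartz_add, trilin_add_mid, inner_add_right]; ring

theorem defect_add_third :
    defect r f₁ f₂ (f + g) f₄ = defect r f₁ f₂ f f₄ + defect r f₁ f₂ g f₄ := by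
  have hq : quarticS f₁ f₂ (f + g) f₄ = quarticS f₁ f₂ f f₄ + quarticS f₁ f₂ g f₄ := by
    rw [quarticS, quarticS, quarticS,
      ← integral_add (integrable_quartic _ _ _ _) (integrable_quartic _ _ _ _)]
    congr 1; funext x
    simp only [_root_.add_apply, map_add]; ring
  rw [defect, defect, defect, hq, ofSchwartz_add, trilin_add_right, inner_add_right]; ring

theorem defect_add_fourth :
    defect r f₁ f₂ f₃ (f + g) = defect r f₁ f₂ f₃ f + defect r f₁ f₂ f₃ g := by
  have hq : quarticS f₁ f₂ f₃ (f + g) = quarticS f₁ f₂ f₃ f + quarticS f₁ f₂ f₃ g := by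
    rw [quarticS, quarticS, quarticS,
      ← integral_add (integrable_quartic _ _ _ _) (integrable_quartic _ _ _ _)]
    congr 1; funext x
    simp only [_root_.add_apply, map_add]; ring
  rw [defect, defect, defect, hq, ofSchwartz_add, inner_add_left]; ring

/-- The span of the Hermite functions of level `n`. -/
def hermSpan (n : ℕ) : Submodule ℂ 𝓢(Plane, ℂ) := Submodule.span ℂ (Set.range fun a => hermS a n)

theorem hermSpan_induction {n : ℕ} {P : 𝓢(Plane, ℂ) → Prop} (gen : ∀ a, P (hermS a n))
    (add : ∀ f g, P f → P g → P (f + g)) (smul : ∀ (c : ℂ) f, P f → P (c • f)) :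
    ∀ f ∈ hermSpan n, P f := by
  intro f hf
  induction hf using Submodule.span_induction with
  | mem x h => obtain ⟨a, rfl⟩ := h; exact gen a
  | zero => simpa using smul 0 _ (gen 0)
  | add x y _ _ hx hy => exact add x y hx hy
  | smul c x _ hx => exact smul c x hx

variable {f₁ f₂ f₃ f₄}

theorem defect_hermS (a b c d : Fin 2 → ℂ) (n₁ n₂ n₃ n₄ : ℕ) :
    defect (if n₁ + n₂ = n₃ + n₄ then 2 * π ^ 2 else 0) (hermS a n₁) (hermS b n₂) (hermS c n₃)
      (hermS d n₄) = 0 := by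
  have h := crE_hermFun a b c d n₁ n₂ n₃ n₄
  rw [← crE_congr (hermL_ae n₁ a) (hermL_ae n₂ b) (hermL_ae n₃ c) (hermL_ae n₄ d),
    ← inner_trilin] at h
  rw [defect, sub_eq_zero]
  refine h.trans ?_
  simp only [quarticS, hermS_apply]
  split_ifs <;> simp

/-- For a fixed coefficient `r` the defect is additive and homogeneous up to conjugation in each
slot, so its vanishing spreads from the generators one slot at a time. -/
theorem defect_eq_zero {n₁ n₂ n₃ n₄ : ℕ} (h₁ : f₁ ∈ hermSpan n₁) (h₂ : f₂ ∈ hermSpan n₂)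
    (h₃ : f₃ ∈ hermSpan n₃) (h₄ : f₄ ∈ hermSpan n₄) :
    defect (if n₁ + n₂ = n₃ + n₄ then 2 * π ^ 2 else 0) f₁ f₂ f₃ f₄ = 0 := by
  set r : ℂ := if n₁ + n₂ = n₃ + n₄ then 2 * π ^ 2 else 0 with hr
  have s1 : ∀ a b c, defect r (hermS a n₁) (hermS b n₂) (hermS c n₃) f₄ = 0 := fun a b c => by
    refine hermSpan_induction (P := fun f => defect r _ _ _ f = 0)
      (fun d => defect_hermS a b c d n₁ n₂ n₃ n₄) (fun f g hf hg => ?_) (fun k f hf => ?_) f₄ h₄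
    · rw [defect_add_fourth, hf, hg, add_zero]
    · have := defect_smul r (hermS a n₁) (hermS b n₂) (hermS c n₃) f 1 1 1 k
      simpa [hf] using this
  have s2 : ∀ a b, defect r (hermS a n₁) (hermS b n₂) f₃ f₄ = 0 := fun a b => by
    refine hermSpan_induction (P := fun f => defect r _ _ f _ = 0)
      (fun c => s1 a b c) (fun f g hf hg => ?_) (fun k f hf => ?_) f₃ h₃
    · rw [defect_add_third, hf, hg, add_zero]
    · have := defect_smul r (hermS a n₁) (hermS b n₂) f f₄ 1 1 k 1
      simpa [hf] using this
  have s3 : ∀ a, defect r (hermS a n₁) f₂ f₃ f₄ = 0 := fun a => by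
    refine hermSpan_induction (P := fun f => defect r _ f _ _ = 0)
      (fun b => s2 a b) (fun f g hf hg => ?_) (fun k f hf => ?_) f₂ h₂
    · rw [defect_add_second, hf, hg, add_zero]
    · have := defect_smul r (hermS a n₁) f f₃ f₄ 1 k 1 1
      simpa [hf] using this
  refine hermSpan_induction (P := fun f => defect r f _ _ _ = 0)
    (fun a => s3 a) (fun f g hf hg => ?_) (fun k f hf => ?_) f₁ h₁
  · rw [defect_add_first, hf, hg, add_zero]
  · have := defect_smul r f f₂ f₃ f₄ k 1 1 1
    simpa [hf] using this

/-- Eigenfunctions have Schwartz representatives, which makes all products in the series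
square-integrable or integrable. -/
theorem exists_hermSpan_of_mem {n : ℕ} {u : L2} (hu : u ∈ eigenspace n) :
    ∃ f ∈ hermSpan n, ofSchwartz f = u := by
  rw [eigenspace_eq_span] at hu
  have : Submodule.span ℂ (Set.range (hermL n)) =
      (hermSpan n).map (ofSchwartzCLM : 𝓢(Plane, ℂ) →ₗ[ℂ] L2) := by
    rw [hermSpan, Submodule.map_span, ← Set.range_comp]; rfl
  rw [this] at hu
  obtain ⟨f, hf, rfl⟩ := hu
  exact ⟨f, hf, rfl⟩

/-! ### The terms of the series -/

theorem exists_schwartz_proj (n : ℕ) (u : L2) :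
    ∃ f ∈ hermSpan n, ofSchwartz f = proj n u ∧ ⇑(proj n u) =ᵐ[volume] f := by
  obtain ⟨f, hf, h⟩ := exists_hermSpan_of_mem (proj_mem n u)
  exact ⟨f, hf, h, by rw [← h]; exact ofSchwartz_ae f⟩

theorem memLp_cubicProduct (u₁ u₂ u₃ : L2) (n₁ n₂ n₃ : ℕ) :
    MemLp (cubicProduct u₁ u₂ u₃ n₁ n₂ n₃) 2 := by
  obtain ⟨f₁, -, -, e₁⟩ := exists_schwartz_proj n₁ u₁
  obtain ⟨f₂, -, -, e₂⟩ := exists_schwartz_proj n₂ u₂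
  obtain ⟨f₃, -, -, e₃⟩ := exists_schwartz_proj n₃ u₃
  refine (memLp_congr_ae ?_).2 (memLp_cubic f₁ f₂ f₃)
  filter_upwards [e₁, e₂, e₃] with x h₁ h₂ h₃
  rw [cubicProduct, h₁, h₂, h₃]

theorem integrable_quarticProduct (u₁ u₂ u₃ u₄ : L2) (n₁ n₂ n₃ n₄ : ℕ) :
    Integrable (quarticProduct u₁ u₂ u₃ u₄ n₁ n₂ n₃ n₄) :=
  (memLp_cubicProduct u₁ u₂ u₃ n₁ n₂ n₃).integrable_mul (Lp.memLp (proj n₄ u₄)).star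

theorem toL2_cubicProduct_ae (u₁ u₂ u₃ : L2) (n₁ n₂ n₃ : ℕ) :
    ⇑(toL2 (cubicProduct u₁ u₂ u₃ n₁ n₂ n₃)) =ᵐ[volume] cubicProduct u₁ u₂ u₃ n₁ n₂ n₃ := by
  rw [toL2, dif_pos (memLp_cubicProduct u₁ u₂ u₃ n₁ n₂ n₃)]
  exact MemLp.coeFn_toLp _

theorem inner_cubicTerm (u₁ u₂ u₃ u₄ : L2) (n : ℕ × ℕ × ℕ × ℕ) :
    inner ℂ u₄ (cubicTerm u₁ u₂ u₃ n) = quarticTerm u₁ u₂ u₃ u₄ n := by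
  rw [cubicTerm, ← inner_proj, L2.inner_def, quarticTerm]
  refine integral_congr_ae ?_
  filter_upwards [toL2_cubicProduct_ae u₁ u₂ u₃ n.1 n.2.1 n.2.2.1] with x hx
  rw [hx, RCLike.inner_apply]; rfl

/-- Pair with `v` and move the outer projection onto it; all four arguments then lie in eigenspaces
and `defect_eq_zero` applies. -/
theorem proj_trilin_proj (u₁ u₂ u₃ : L2) (n : ℕ × ℕ × ℕ × ℕ) :
    proj n.2.2.2 (trilin (proj n.1 u₁) (proj n.2.1 u₂) (proj n.2.2.1 u₃)) =
      if Resonant n then ((2 * π ^ 2 : ℝ) : ℂ) • cubicTerm u₁ u₂ u₃ n else 0 := by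
  obtain ⟨f₁, m₁, s₁, e₁⟩ := exists_schwartz_proj n.1 u₁
  obtain ⟨f₂, m₂, s₂, e₂⟩ := exists_schwartz_proj n.2.1 u₂
  obtain ⟨f₃, m₃, s₃, e₃⟩ := exists_schwartz_proj n.2.2.1 u₃
  refine ext_inner_left ℂ fun v => ?_
  obtain ⟨f₄, m₄, s₄, e₄⟩ := exists_schwartz_proj n.2.2.2 v
  have h := sub_eq_zero.1 (defect_eq_zero m₁ m₂ m₃ m₄)
  rw [s₁, s₂, s₃, s₄] at h
  have hq : quarticTerm u₁ u₂ u₃ v n = quarticS f₁ f₂ f₃ f₄ := by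
    refine integral_congr_ae ?_
    filter_upwards [e₁, e₂, e₃, e₄] with x h₁ h₂ h₃ h₄
    rw [quarticProduct, h₁, h₂, h₃, h₄]
  rw [← inner_proj, h, ← hq]
  split_ifs
  · rw [inner_smul_right, inner_cubicTerm]; push_cast; ring
  · simp

end

/-! ### Summation over boxes -/

theorem trilin_sum_left {ι : Type*} (s : Finset ι) (F : ι → L2) (u₂ u₃ : L2) :
    trilin (∑ i ∈ s, F i) u₂ u₃ = ∑ i ∈ s, trilin (F i) u₂ u₃ :=
  map_sum (AddMonoidHom.mk' (fun u => trilin u u₂ u₃) fun a b => trilin_add_left a b u₂ u₃) F s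

theorem trilin_sum_mid {ι : Type*} (s : Finset ι) (F : ι → L2) (u₁ u₃ : L2) :
    trilin u₁ (∑ i ∈ s, F i) u₃ = ∑ i ∈ s, trilin u₁ (F i) u₃ :=
  map_sum (AddMonoidHom.mk' (fun u => trilin u₁ u u₃) fun a b => trilin_add_mid a b u₁ u₃) F s

theorem trilin_sum_right {ι : Type*} (s : Finset ι) (F : ι → L2) (u₁ u₂ : L2) :
    trilin u₁ u₂ (∑ i ∈ s, F i) = ∑ i ∈ s, trilin u₁ u₂ (F i) :=
  map_sum (AddMonoidHom.mk' (fun u => trilin u₁ u₂ u) fun a b => trilin_add_right a b u₁ u₂) F s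

/-- The nonresonant components vanish, so the filtered sum is the sum over the whole box, which
multilinearity folds up. -/
theorem sum_box_eq (u₁ u₂ u₃ : L2) (A : Finset ℕ × Finset ℕ × Finset ℕ × Finset ℕ) :
    ∑ n ∈ (A.1 ×ˢ A.2.1 ×ˢ A.2.2.1 ×ˢ A.2.2.2).filter Resonant,
      ((2 * π ^ 2 : ℝ) : ℂ) • cubicTerm u₁ u₂ u₃ n =
    projSum A.2.2.2 (trilin (projSum A.1 u₁) (projSum A.2.1 u₂) (projSum A.2.2.1 u₃)) := by
  rw [Finset.sum_filter]
  simp only [← proj_trilin_proj, Finset.sum_product]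
  rw [projSum_apply A.1, trilin_sum_left, map_sum]
  refine Finset.sum_congr rfl fun n₁ _ => ?_
  rw [projSum_apply A.2.1, trilin_sum_mid, map_sum]
  refine Finset.sum_congr rfl fun n₂ _ => ?_
  rw [projSum_apply A.2.2.1, trilin_sum_right, map_sum]
  refine Finset.sum_congr rfl fun n₃ _ => ?_
  rw [projSum_apply]

/-- Strong convergence suffices with a moving argument, because the truncations are contractions. -/
theorem tendsto_projSum_of_tendsto {ι : Type*} {F : Filter ι} {A : ι → Finset ℕ}
    (hA : Tendsto A F atTop) {X : ι → L2} {x : L2} (hX : Tendsto X F (𝓝 x)) :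
    Tendsto (fun i => projSum (A i) (X i)) F (𝓝 x) := by
  have h1 : Tendsto (fun i => projSum (A i) x) F (𝓝 x) := (tendsto_projSum x).comp hA
  have h2 : Tendsto (fun i => projSum (A i) (X i - x)) F (𝓝 0) := by
    refine squeeze_zero_norm (fun i => norm_projSum_le _ _) ?_
    have := (hX.sub_const x).norm
    simpa using this
  have h3 := h2.add h1
  rw [zero_add] at h3
  refine h3.congr fun i => ?_
  rw [map_sub, sub_add_cancel]

theorem tendsto_trilin {ι : Type*} {F : Filter ι} {X₁ X₂ X₃ : ι → L2} {x₁ x₂ x₃ : L2}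
    (h₁ : Tendsto X₁ F (𝓝 x₁)) (h₂ : Tendsto X₂ F (𝓝 x₂)) (h₃ : Tendsto X₃ F (𝓝 x₃)) :
    Tendsto (fun i => trilin (X₁ i) (X₂ i) (X₃ i)) F (𝓝 (trilin x₁ x₂ x₃)) := by
  have h : Tendsto (fun i => (![X₁ i, X₂ i, X₃ i] : Fin 3 → L2)) F (𝓝 ![x₁, x₂, x₃]) := by
    rw [tendsto_pi_nhds]
    intro j
    fin_cases j
    · exact h₁
    · exact h₂
    · exact h₃
  have hc : Tendsto (fun f : Fin 3 → L2 => trilinMap f) (𝓝 ![x₁, x₂, x₃])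
      (𝓝 (trilinMap ![x₁, x₂, x₃])) := trilinMap.cont.tendsto _
  have h' := hc.comp h
  simp only [trilinMap_apply] at h'
  exact h'

theorem hasResonantSum_trilin (u₁ u₂ u₃ : L2) :
    HasResonantSum (fun n => ((2 * π ^ 2 : ℝ) : ℂ) • cubicTerm u₁ u₂ u₃ n) (trilin u₁ u₂ u₃) := by
  unfold HasResonantSum
  simp only [sum_box_eq]
  have t1 : Tendsto (fun A : Finset ℕ × Finset ℕ × Finset ℕ × Finset ℕ => A.1) atTop atTop := by
    rw [← prod_atTop_atTop_eq]; exact tendsto_fst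
  have t2 : Tendsto (fun A : Finset ℕ × Finset ℕ × Finset ℕ × Finset ℕ => A.2.1) atTop atTop := by
    rw [← prod_atTop_atTop_eq, ← prod_atTop_atTop_eq]; exact tendsto_fst.comp tendsto_snd
  have t3 : Tendsto (fun A : Finset ℕ × Finset ℕ × Finset ℕ × Finset ℕ => A.2.2.1) atTop
      atTop := by
    rw [← prod_atTop_atTop_eq, ← prod_atTop_atTop_eq, ← prod_atTop_atTop_eq]
    exact tendsto_fst.comp (tendsto_snd.comp tendsto_snd)
  have t4 : Tendsto (fun A : Finset ℕ × Finset ℕ × Finset ℕ × Finset ℕ => A.2.2.2) atTop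
      atTop := by
    rw [← prod_atTop_atTop_eq, ← prod_atTop_atTop_eq, ← prod_atTop_atTop_eq]
    exact tendsto_snd.comp (tendsto_snd.comp tendsto_snd)
  exact tendsto_projSum_of_tendsto t4 (tendsto_trilin ((tendsto_projSum u₁).comp t1)
    ((tendsto_projSum u₂).comp t2) ((tendsto_projSum u₃).comp t3))

theorem hasResonantSum_crE (u₁ u₂ u₃ u₄ : L2) :
    HasResonantSum (fun n => ((2 * π ^ 2 : ℝ) : ℂ) * quarticTerm u₁ u₂ u₃ u₄ n)
      (crE u₁ u₂ u₃ u₄) := by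
  have h := (hasResonantSum_trilin u₁ u₂ u₃)
  have h2 := ((continuous_const.inner continuous_id :
    Continuous fun x : L2 => inner ℂ u₄ x).tendsto _).comp h
  rw [inner_trilin] at h2
  refine h2.congr fun A => ?_
  rw [Function.comp_apply, inner_sum]
  refine Finset.sum_congr rfl fun n _ => ?_
  rw [inner_smul_right, inner_cubicTerm]

/-! ### Unconditional convergence for Schwartz functions -/

/-- The terms are bounded through `𝓣` rather than through pointwise products: by `proj_trilin_proj`
each is a projection of `𝓣` of projected functions, of norm at most `π ∏ ‖Π_{n_j} f_j‖`. -/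
theorem summable_cubicTerm (f₁ f₂ f₃ : 𝓢(Plane, ℂ)) :
    Summable fun n : {n : ℕ × ℕ × ℕ × ℕ // Resonant n} => ((2 * π ^ 2 : ℝ) : ℂ) •
      cubicTerm (ofSchwartz f₁) (ofSchwartz f₂) (ofSchwartz f₃) n := by
  set φ : {n : ℕ × ℕ × ℕ × ℕ // Resonant n} → ℕ × ℕ × ℕ := fun n =>
    (n.1.1, n.1.2.1, n.1.2.2.1) with hφ
  -- Resonance determines `n₄` from the other three indices.
  have hinj : Function.Injective φ := by
    rintro ⟨⟨a, b, c, d⟩, h⟩ ⟨⟨a', b', c', d'⟩, h'⟩ he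
    simp only [hφ, Prod.mk.injEq, Resonant] at he h h'
    simp only [Subtype.mk.injEq, Prod.mk.injEq]
    omega
  have hs : Summable fun p : ℕ × ℕ × ℕ => ‖proj p.1 (ofSchwartz f₁)‖ *
      (‖proj p.2.1 (ofSchwartz f₂)‖ * ‖proj p.2.2 (ofSchwartz f₃)‖) :=
    (summable_norm_proj_ofSchwartz f₁).mul_of_nonneg
      ((summable_norm_proj_ofSchwartz f₂).mul_of_nonneg (summable_norm_proj_ofSchwartz f₃)
        (fun _ => norm_nonneg _) (fun _ => norm_nonneg _))
      (fun _ => norm_nonneg _) (fun _ => mul_nonneg (norm_nonneg _) (norm_nonneg _))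
  refine Summable.of_norm_bounded ((hs.comp_injective hinj).mul_left π) fun n => ?_
  have h := proj_trilin_proj (ofSchwartz f₁) (ofSchwartz f₂) (ofSchwartz f₃) n.1
  rw [if_pos n.2] at h
  rw [← h]
  refine (norm_proj_le _ _).trans ((norm_trilin_le _ _ _).trans_eq ?_)
  simp only [hφ, Function.comp_apply, mul_assoc]

/-- Boxes eventually contain every finite set of quadruples, so an unconditional sum, once known to
exist, must be the limit over boxes. -/
theorem HasSum.of_hasResonantSum {M : Type*} [AddCommGroup M] [TopologicalSpace M] [T2Space M]
    {a : ℕ × ℕ × ℕ × ℕ → M} {s : M} (h : HasResonantSum a s)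
    (hs : Summable fun n : {n : ℕ × ℕ × ℕ × ℕ // Resonant n} => a n) :
    HasSum (fun n : {n : ℕ × ℕ × ℕ × ℕ // Resonant n} => a n) s := by
  obtain ⟨s', hs'⟩ := hs
  set box : Finset ℕ × Finset ℕ × Finset ℕ × Finset ℕ → Finset {n : ℕ × ℕ × ℕ × ℕ // Resonant n} :=
    fun A => (A.1 ×ˢ A.2.1 ×ˢ A.2.2.1 ×ˢ A.2.2.2).subtype Resonant with hbox
  have hb : Tendsto box atTop atTop := by
    rw [tendsto_atTop]
    intro S
    filter_upwards [eventually_ge_atTop ((S.image fun n => n.1.1, S.image fun n => n.1.2.1,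
      S.image fun n => n.1.2.2.1, S.image fun n => n.1.2.2.2) :
        Finset ℕ × Finset ℕ × Finset ℕ × Finset ℕ)] with A hA n hn
    simp only [hbox, Finset.mem_subtype, Finset.mem_product]
    exact ⟨hA.1 (Finset.mem_image_of_mem _ hn), hA.2.1 (Finset.mem_image_of_mem _ hn),
      hA.2.2.1 (Finset.mem_image_of_mem _ hn), hA.2.2.2 (Finset.mem_image_of_mem _ hn)⟩
  have h1 : Tendsto (fun A => ∑ n ∈ box A, a n) atTop (𝓝 s') := by
    rw [HasSum, SummationFilter.unconditional_filter] at hs'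
    exact hs'.comp hb
  have h2 : s' = s := by
    refine tendsto_nhds_unique h1 (h.congr fun A => ?_)
    rw [hbox, Finset.sum_subtype_eq_sum_filter]
  rwa [h2] at hs'

theorem hasSum_schwartz_trilin (f₁ f₂ f₃ : 𝓢(Plane, ℂ)) :
    HasSum (fun n : {n : ℕ × ℕ × ℕ × ℕ // Resonant n} => ((2 * π ^ 2 : ℝ) : ℂ) •
      cubicTerm (ofSchwartz f₁) (ofSchwartz f₂) (ofSchwartz f₃) n)
      (trilin (ofSchwartz f₁) (ofSchwartz f₂) (ofSchwartz f₃)) :=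
  HasSum.of_hasResonantSum (a := fun n => ((2 * π ^ 2 : ℝ) : ℂ) •
      cubicTerm (ofSchwartz f₁) (ofSchwartz f₂) (ofSchwartz f₃) n)
    (s := trilin (ofSchwartz f₁) (ofSchwartz f₂) (ofSchwartz f₃))
    (hasResonantSum_trilin _ _ _) (summable_cubicTerm f₁ f₂ f₃)

theorem hasSum_schwartz_crE (f₁ f₂ f₃ f₄ : 𝓢(Plane, ℂ)) :
    HasSum (fun n : {n : ℕ × ℕ × ℕ × ℕ // Resonant n} => ((2 * π ^ 2 : ℝ) : ℂ) *
      quarticTerm (ofSchwartz f₁) (ofSchwartz f₂) (ofSchwartz f₃) (ofSchwartz f₄) n)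
      (crE f₁ f₂ f₃ f₄) := by
  have h := (hasSum_schwartz_trilin f₁ f₂ f₃).mapL (innerSL ℂ (ofSchwartz f₄))
  have e : crE f₁ f₂ f₃ f₄ = crE (ofSchwartz f₁) (ofSchwartz f₂) (ofSchwartz f₃) (ofSchwartz f₄) :=
    crE_congr (ofSchwartz_ae f₁).symm (ofSchwartz_ae f₂).symm (ofSchwartz_ae f₃).symm
      (ofSchwartz_ae f₄).symm
  rw [e, ← inner_trilin]
  have e' : (fun n : {n : ℕ × ℕ × ℕ × ℕ // Resonant n} => ((2 * π ^ 2 : ℝ) : ℂ) *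
      quarticTerm (ofSchwartz f₁) (ofSchwartz f₂) (ofSchwartz f₃) (ofSchwartz f₄) n) =
      fun n : {n : ℕ × ℕ × ℕ × ℕ // Resonant n} => innerSL ℂ (ofSchwartz f₄)
        (((2 * π ^ 2 : ℝ) : ℂ) • cubicTerm (ofSchwartz f₁) (ofSchwartz f₂) (ofSchwartz f₃) n) := by
    funext n
    rw [innerSL_apply_apply, inner_smul_right, inner_cubicTerm]
  rw [e']
  exact h

/-! ### The evolution equations -/

theorem solvesCR_iff (u : ℝ → L2) :
    SolvesCR u ↔ ∀ t, HasDerivAt u (-Complex.I • trilin (u t) (u t) (u t)) t :=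
  forall_congr' fun _ => ⟨fun ⟨_, h⟩ => h, fun h => ⟨memLp_crT_L2 _ _ _, h⟩⟩

theorem two_pi_sq_ne_zero : ((2 * π ^ 2 : ℝ) : ℂ) ≠ 0 := by
  exact_mod_cast (by positivity : (2 * π ^ 2 : ℝ) ≠ 0)

/-- By uniqueness of limits the resonant nonlinearity is a function of `u`, namely `𝓣(u,u,u)/(2π²)`.
-/
theorem hasResonantSum_cubicTerm_iff (u g : L2) :
    HasResonantSum (cubicTerm u u u) g ↔ g = ((2 * π ^ 2 : ℝ) : ℂ)⁻¹ • trilin u u u := by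
  have h : HasResonantSum (cubicTerm u u u) (((2 * π ^ 2 : ℝ) : ℂ)⁻¹ • trilin u u u) := by
    refine ((hasResonantSum_trilin u u u).const_smul ((2 * π ^ 2 : ℝ) : ℂ)⁻¹).congr fun A => ?_
    rw [Finset.smul_sum]
    refine Finset.sum_congr rfl fun n _ => ?_
    rw [smul_smul, inv_mul_cancel₀ two_pi_sq_ne_zero, one_smul]
  exact ⟨fun hg => tendsto_nhds_unique hg h, fun hg => hg ▸ h⟩

theorem solvesResonant_iff (v : ℝ → L2) :
    SolvesResonant v ↔ ∀ t, HasDerivAt v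
      (-Complex.I • ((2 * π ^ 2 : ℝ) : ℂ)⁻¹ • trilin (v t) (v t) (v t)) t := by
  refine forall_congr' fun t => ?_
  simp only [hasResonantSum_cubicTerm_iff, exists_eq_left]

theorem solvesCR_iff_solvesResonant (u : ℝ → L2) :
    SolvesCR u ↔ SolvesResonant fun t => u (t / (2 * π ^ 2)) := by
  have hκ : (2 * π ^ 2 : ℝ) ≠ 0 := by positivity
  have hc : ∀ (c : ℝ) (v : L2), c • v = (c : ℂ) • v := fun c v => (Complex.coe_smul c v).symm
  rw [solvesCR_iff, solvesResonant_iff]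
  constructor
  · intro h t
    have h1 := (h (t / (2 * π ^ 2))).scomp t ((hasDerivAt_id t).div_const (2 * π ^ 2))
    refine h1.congr_deriv ?_
    rw [hc, smul_comm, one_div, Complex.ofReal_inv]
  · intro h s
    -- Conversely, `u` is recovered from `v` by running time at speed `2π²`; the chain rule cancels
    -- the factor.
    have h0 := h (2 * π ^ 2 * s)
    have h1 := HasDerivAt.scomp s h0 ((hasDerivAt_id s).const_mul (2 * π ^ 2))
    have e : ∀ s : ℝ, 2 * π ^ 2 * s / (2 * π ^ 2) = s := fun s => mul_div_cancel_left₀ s hκ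
    have e2 : ((fun t => u (t / (2 * π ^ 2))) ∘ HMul.hMul (2 * π ^ 2 : ℝ)) = u := by
      funext s; simp only [Function.comp_apply, e]
    rw [e2] at h1
    refine h1.congr_deriv ?_
    simp only [e]
    rw [mul_one, hc, smul_comm, smul_inv_smul₀ two_pi_sq_ne_zero]

theorem integrable_crIntegrand_mul_L2 (u₁ u₂ u₃ u₄ : L2) :
    Integrable (fun p : ℝ × Plane × Plane =>
      crIntegrand u₁ u₂ u₃ p.1 p.2.1 p.2.2 * conj (u₄ p.2.2)) := by
  have h := integrable_crIntegrand_mul (measurable_L2 u₁) (measurable_L2 u₂) (measurable_L2 u₃)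
    (measurable_L2 u₄) (Lp.memLp u₁) (Lp.memLp u₂) (Lp.memLp u₃) (Lp.memLp u₄)
  exact ((volume_preserving_prodAssoc (α₁ := ℝ) (β₁ := Plane) (γ₁ := Plane)).symm.integrable_comp_emb
    (MeasurableEquiv.measurableEmbedding _)).2 h

end CRHermite

end

theorem mainTheorem2 :
    -- the quartic form and the trilinear operator on `L²`
    (∀ f₁ f₂ f₃ f₄ : CRHermite.L2,
      -- the integrals defining `𝓣` and `𝓔` converge absolutely
      (∀ᵐ z : CRHermite.Plane, Integrable (fun p : ℝ × CRHermite.Plane =>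
        CRHermite.crIntegrand f₁ f₂ f₃ p.1 p.2 z)) ∧
      Integrable (fun p : ℝ × CRHermite.Plane × CRHermite.Plane =>
        CRHermite.crIntegrand f₁ f₂ f₃ p.1 p.2.1 p.2.2 * conj (f₄ p.2.2)) ∧
      -- the terms of the two series are well defined
      (∀ n₁ n₂ n₃ n₄ : ℕ, Integrable (CRHermite.quarticProduct f₁ f₂ f₃ f₄ n₁ n₂ n₃ n₄)) ∧
      (∀ n₁ n₂ n₃ : ℕ, MemLp (CRHermite.cubicProduct f₁ f₂ f₃ n₁ n₂ n₃) 2) ∧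
      -- the formula for `𝓔`
      CRHermite.HasResonantSum
        (fun n => ((2 * π ^ 2 : ℝ) : ℂ) * CRHermite.quarticTerm f₁ f₂ f₃ f₄ n)
        (CRHermite.crE f₁ f₂ f₃ f₄) ∧
      -- the formula for `𝓣`
      ∃ hT : MemLp (CRHermite.crT f₁ f₂ f₃) 2,
        CRHermite.HasResonantSum
          (fun n => ((2 * π ^ 2 : ℝ) : ℂ) • CRHermite.cubicTerm f₁ f₂ f₃ n)
          (hT.toLp (CRHermite.crT f₁ f₂ f₃))) ∧
    -- for Schwartz functions both series converge unconditionally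
    (∀ f₁ f₂ f₃ f₄ : 𝓢(CRHermite.Plane, ℂ),
      HasSum (fun n : {n : ℕ × ℕ × ℕ × ℕ // CRHermite.Resonant n} =>
          ((2 * π ^ 2 : ℝ) : ℂ) *
            CRHermite.quarticTerm (CRHermite.ofSchwartz f₁) (CRHermite.ofSchwartz f₂) (CRHermite.ofSchwartz f₃) (CRHermite.ofSchwartz f₄) n)
        (CRHermite.crE f₁ f₂ f₃ f₄) ∧
      ∃ hT : MemLp (CRHermite.crT f₁ f₂ f₃) 2,
        HasSum (fun n : {n : ℕ × ℕ × ℕ × ℕ // CRHermite.Resonant n} =>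
            ((2 * π ^ 2 : ℝ) : ℂ) •
              CRHermite.cubicTerm (CRHermite.ofSchwartz f₁) (CRHermite.ofSchwartz f₂) (CRHermite.ofSchwartz f₃) n)
          (hT.toLp (CRHermite.crT f₁ f₂ f₃))) ∧
    -- the two evolution equations agree up to a rescaling of time
    (∀ u : ℝ → CRHermite.L2,
      CRHermite.SolvesCR u ↔ CRHermite.SolvesResonant (fun t => u (t / (2 * π ^ 2)))) := by
  refine ⟨fun f₁ f₂ f₃ f₄ => ⟨CRHermite.ae_integrable_L2 f₁ f₂ f₃,
    CRHermite.integrable_crIntegrand_mul_L2 f₁ f₂ f₃ f₄,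
    CRHermite.integrable_quarticProduct f₁ f₂ f₃ f₄, CRHermite.memLp_cubicProduct f₁ f₂ f₃,
    CRHermite.hasResonantSum_crE f₁ f₂ f₃ f₄, CRHermite.memLp_crT_L2 f₁ f₂ f₃,
    CRHermite.hasResonantSum_trilin f₁ f₂ f₃⟩,
    fun f₁ f₂ f₃ f₄ => ⟨CRHermite.hasSum_schwartz_crE f₁ f₂ f₃ f₄, ?_⟩,
    CRHermite.solvesCR_iff_solvesResonant⟩
  -- `crT` takes the same values on the Schwartz functions as on their `L²` representatives, at
  -- every point.
  rw [← CRHermite.crT_congr (CRHermite.ofSchwartz_ae f₁) (CRHermite.ofSchwartz_ae f₂)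
    (CRHermite.ofSchwartz_ae f₃)]
  exact ⟨CRHermite.memLp_crT_L2 _ _ _, CRHermite.hasSum_schwartz_trilin f₁ f₂ f₃⟩
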